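/- **Setting.** Let $\varkappa,m>0$ with $\beta:=\varkappa-m>0$, let $0\le a\in L^1(\mathbb R)\cap L^\infty(\mathbb R)$ with $\int_{\mathbb R}a(x)\,dx=1$, and let $E:=L^\infty(\mathbb R)$ with the essential supremum norm. Pointwise relations between elements of $E$ and limits of such elements are understood up to null sets. Let $0\le u_0\in E$ be such that $u_0\ge\delta$ a.e. on $[x_0-r,x_0+r]$ for some $\delta,r>0$, $x_0\in\mathbb R$. Let $w:[0,\infty)\to E$ be continuous on $[0,\infty)$ and continuously differentiable on $(0,\infty)$ in the norm of $E$, with $$\frac{\partial w}{\partial t}(x,t)=\varkappa\int_{\mathbb R}a(x-y)\,w(y,t)\,dy-m\,w(x,t)\quad(t>0),\qquad w(x,0)=u_0(x).$$ **Classes of functions.** A function $b:\mathbb R\to\mathbb R_+=[0,\infty)$ is called * *long-tailed* if, for some $\rho\ge0$, $b(x)>0$ for all $x\ge\rho$, and $\lim_{x\to\infty}b(x+y)/b(x)=1$ for every $y\ge0$; * *tail-decreasing* (*tail-continuous*) if, for some $\rho\ge0$, $b$ is positive and strictly decreasing to $0$ (positive and continuous, respectively) on $(\rho,\infty)$; *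 *sub-exponential in the sense of densities* if $b\in L^1(\mathbb R_+)\cap L^\infty(\mathbb R_+)$, $b$ is long-tailed and $\int_0^x b(x-y)b(y)\,dy\sim2\bigl(\int_{\mathbb R_+}b(y)\,dy\bigr)b(x)$ as $x\to\infty$; * *sub-exponential in the sense of distributions* if $b$ is bounded, non-increasing on $\mathbb R$ with $b(x)\to0$ as $x\to\infty$, long-tailed, and $-\int_{\mathbb R}b(x-y)\,db(y)\sim2\,b(-\infty)\,b(x)$ as $x\to\infty$, where $-db$ is the Lebesgue–Stieltjes measure with $-db\bigl((x,y]\bigr)=b(x+)-b(y+)$ and $b(-\infty)=\lim_{x\to-\infty}b(x)$. $\mathcal S(\mathbb R)$ is the set of bounded $b:\mathbb R\to\mathbb R_+$ such that both $b(x)$ and $b(-x)$ are tail-decreasing, tail-continuous and sub-exponential in the sense of densities. $\mathcal{MS}(\mathbb R)$ is the set of bounded monotone $b:\mathbb R\to\mathbb R_+$ with $\lim_{x\to\infty}b(x)=0$ which are tail-decreasing, tail-continuous and sub-exponential in the sense of densities or in the sense of distributions. For such $b$ and all large $t$, let $r(t,b)$ be the solution $x$ of $b(x)=e^{-\beta t}$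 in the right tail of $b$ (that is, the largest solution), and, for $b\in\mathcal S(\mathbb R)$, let $l(t,b)$ be the number such that $-l(t,b)$ is the solution in the left tail (the smallest one). Put $$\Lambda_\varepsilon^+(t,b):=\begin{cases}[-l(t+\varepsilon t,b),\,r(t+\varepsilon t,b)],&b\in\mathcal S(\mathbb R),\\(-\infty,\,r(t+\varepsilon t,b)],&b\in\mathcal{MS}(\mathbb R).\end{cases}$$ **Proposition.** Suppose that one of the following holds for some $\rho>0$: 1. $\lim_{x\to\pm\infty}u_0(x)=0$, and $b\in\mathcal S(\mathbb R)$ satisfies $\max\{a(x),u_0(x)\}\le b(x)$ for $|x|>\rho$; 2. $\lim_{x\to\infty}u_0(x)=0$, $\operatorname{ess\,inf}_{x\le-\rho'}u_0(x)>0$ for some $\rho'\ge0$, and $b\in\mathcal{MS}(\mathbb R)$ satisfies $\max\bigl\{\int_x^\infty a(y)\,dy,\,u_0(x)\bigr\}\le b(x)$ for $x>\rho$. Then, for each $\varepsilon\in(0,1)$, $$\lim_{t\to\infty}\ \operatorname*{ess\,sup}_{x\in\mathbb R\setminus\Lambda_\varepsilon^+(t,b)}w(x,t)=0.$$ -/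

import Mathlib

open Filter Topology MeasureTheory Set Asymptotics
open scoped ENNReal

/-! ## Tails of functions -/

/-- (Right-side) long-tailed: eventually positive, and `b (x + y) / b x → 1` for each `y ≥ 0`. -/
def LongTailed (b : ℝ → ℝ) : Prop :=
  (∃ ρ : ℝ, 0 ≤ ρ ∧ ∀ x, ρ ≤ x → 0 < b x) ∧
    ∀ y : ℝ, 0 ≤ y → Tendsto (fun x => b (x + y) / b x) atTop (𝓝 1)

/-- (Right-side) tail-decreasing: positive and strictly decreasing to `0` on some `(ρ, ∞)`. -/
def TailDecreasing (b : ℝ → ℝ) : Prop :=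
  ∃ ρ : ℝ, 0 ≤ ρ ∧ (∀ x, ρ < x → 0 < b x) ∧ StrictAntiOn b (Ioi ρ) ∧ Tendsto b atTop (𝓝 0)

/-- (Right-side) tail-continuous: positive and continuous on some `(ρ, ∞)`. -/
def TailContinuous (b : ℝ → ℝ) : Prop :=
  ∃ ρ : ℝ, 0 ≤ ρ ∧ (∀ x, ρ < x → 0 < b x) ∧ ContinuousOn b (Ioi ρ)

/-- Sub-exponential on `ℝ₊` in the sense of densities. -/
structure SubexpDensity (b : ℝ → ℝ) : Prop where
  integrable : MemLp b 1 (volume.restrict (Ioi 0))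
  essBounded : MemLp b ∞ (volume.restrict (Ioi 0))
  longTailed : LongTailed b
  conv_equiv : (fun x : ℝ => ∫ y in (0 : ℝ)..x, b (x - y) * b y)
    ~[atTop] (fun x => 2 * (∫ y in Ioi (0 : ℝ), b y) * b x)

/-- The Lebesgue--Stieltjes measure `-db` of a non-increasing function `b`:
it gives the mass `b(x+) - b(y+)` to the interval `(x, y]`. -/
noncomputable def negStieltjes {b : ℝ → ℝ} (hb : Antitone b) : Measure ℝ :=
  (Antitone.neg hb).stieltjesFunction.measure

/-- Sub-exponential in the sense of distributions, for a function `b` which is non-increasing on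
`ℝ` with limit `0` at `∞`: `b` is bounded, long-tailed, and the tail `-∫ b (x - y) db(y)` of the
convolution square is equivalent to `2 b(-∞) b(x)` as `x → ∞`; here `b(-∞) = ⨆ y, b y`. That is,
`b / b(-∞)` is the tail of a (whole-line) sub-exponential probability distribution. -/
structure SubexpDistr (b : ℝ → ℝ) : Prop where
  bounded : ∃ M : ℝ, ∀ x, b x ≤ M
  antitone : Antitone b
  tendsto_zero : Tendsto b atTop (𝓝 0)
  longTailed : LongTailed b
  conv_equiv : (fun x : ℝ => ∫ y, b (x - y) ∂(negStieltjes antitone))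
    ~[atTop] (fun x => 2 * (⨆ y, b y) * b x)

/-- The class `S(ℝ₊)`: bounded functions `ℝ → ℝ₊`, sub-exponential on `ℝ₊` in the sense of
densities, tail-decreasing and tail-continuous. -/
structure ClassSRight (b : ℝ → ℝ) : Prop where
  nonneg : ∀ x, 0 ≤ b x
  bounded : ∃ M : ℝ, ∀ x, b x ≤ M
  subexp : SubexpDensity b
  tailDecreasing : TailDecreasing b
  tailContinuous : TailContinuous b

/-- The analogue of `S(ℝ₊)` with sub-exponentiality in the sense of distributions. -/
structure ClassSRightDistr (b : ℝ → ℝ) : Prop where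
  nonneg : ∀ x, 0 ≤ b x
  bounded : ∃ M : ℝ, ∀ x, b x ≤ M
  subexp : SubexpDistr b
  tailDecreasing : TailDecreasing b
  tailContinuous : TailContinuous b

/-- The class `S(ℝ) = S(ℝ₊) ∩ S(ℝ₋)`. -/
def ClassS (b : ℝ → ℝ) : Prop :=
  ClassSRight b ∧ ClassSRight (fun x => b (-x))

/-- The class `M(ℝ)`: bounded monotone functions `ℝ → ℝ₊` with limit `0` at `∞`. -/
structure ClassM (b : ℝ → ℝ) : Prop where
  nonneg : ∀ x, 0 ≤ b x
  bounded : ∃ M : ℝ, ∀ x, b x ≤ M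
  monotone : Monotone b ∨ Antitone b
  tendsto_zero : Tendsto b atTop (𝓝 0)

/-- The class `MS(ℝ)`: functions from `M(ℝ)` which are tail-decreasing, tail-continuous and
sub-exponential, in the sense of densities or in the sense of distributions. -/
def ClassMS (b : ℝ → ℝ) : Prop :=
  ClassM b ∧ (ClassSRight b ∨ ClassSRightDistr b)

/-! ## Fronts -/

/-- `r(t, b)`: the solution `x` of `b x = e^{-βt}` in the tail of `b`, that is, the largest one. -/
noncomputable def rightFront (β : ℝ) (b : ℝ → ℝ) (t : ℝ) : ℝ :=
  sSup {x : ℝ | b x = Real.exp (-(β * t))}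

/-- `l(t, b)`: the solution of `b (-l) = e^{-βt}` with `-l` in the left tail of `b`. -/
noncomputable def leftFront (β : ℝ) (b : ℝ → ℝ) (t : ℝ) : ℝ :=
  rightFront β (fun x => b (-x)) t

/-- For large `t`, `rightFront β b t` is the unique solution of `b x = e^{-βt}` in the region
where `b` is strictly decreasing, and it tends to `∞`. -/
theorem rightFront_spec {β : ℝ} (hβ : 0 < β) {b : ℝ → ℝ}
    (hd : TailDecreasing b) (hc : TailContinuous b) :
    Tendsto (rightFront β b) atTop atTop ∧
      ∃ ρ : ℝ, ∀ᶠ t in atTop, ∀ x, ρ < x →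
        (b x = Real.exp (-(β * t)) ↔ x = rightFront β b t) := by
  obtain ⟨ρ₁, -, hpos, hanti, hlim⟩ := hd
  obtain ⟨ρ₂, -, -, hcont⟩ := hc
  have hexp : Tendsto (fun t : ℝ => Real.exp (-(β * t))) atTop (𝓝 0) :=
    Real.tendsto_exp_neg_atTop_nhds_zero.comp (tendsto_id.const_mul_atTop hβ)
  have key : ∀ x₁, max ρ₁ ρ₂ < x₁ → ∀ᶠ t in atTop, x₁ ≤ rightFront β b t ∧
      b (rightFront β b t) = Real.exp (-(β * t)) := by
    intro x₁ hx₁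
    have h1 : ρ₁ < x₁ := lt_of_le_of_lt (le_max_left _ _) hx₁
    have h2 : ρ₂ < x₁ := lt_of_le_of_lt (le_max_right _ _) hx₁
    filter_upwards [hexp.eventually_lt_const (hpos x₁ h1)] with t ht
    obtain ⟨x₂, hx₂, hx₁₂⟩ :=
      ((hlim.eventually_lt_const (Real.exp_pos (-(β * t)))).and (eventually_ge_atTop x₁)).exists
    obtain ⟨x, hx, hbx⟩ := intermediate_value_Icc' hx₁₂
      (hcont.mono (fun z hz => lt_of_lt_of_le h2 hz.1)) ⟨hx₂.le, ht.le⟩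
    have hg : IsGreatest {x : ℝ | b x = Real.exp (-(β * t))} x := by
      refine ⟨hbx, fun y hy => ?_⟩
      by_contra hlt
      have hxy : x < y := not_le.mp hlt
      have := hanti (lt_of_lt_of_le h1 hx.1) (lt_of_lt_of_le h1 (hx.1.trans hxy.le)) hxy
      rw [hbx, show b y = _ from hy] at this
      exact lt_irrefl _ this
    have hr : rightFront β b t = x := hg.csSup_eq
    rw [hr]
    exact ⟨hx.1, hbx⟩
  refine ⟨tendsto_atTop.2 fun c => ?_, max ρ₁ ρ₂, ?_⟩
  · filter_upwards [key (max c (max ρ₁ ρ₂ + 1))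
      (lt_of_lt_of_le (lt_add_one _) (le_max_right _ _))] with t ht
    exact (le_max_left _ _).trans ht.1
  · filter_upwards [key (max ρ₁ ρ₂ + 1) (lt_add_one _)] with t ht x hx
    have hr : max ρ₁ ρ₂ < rightFront β b t := lt_of_lt_of_le (lt_add_one _) ht.1
    refine ⟨fun h => ?_, fun h => h ▸ ht.2⟩
    exact hanti.injOn (lt_of_le_of_lt (le_max_left _ _) hx)
      (lt_of_le_of_lt (le_max_left _ _) hr) (h.trans ht.2.symm)

/-! ## The linear equation in `E = L^∞(ℝ)` -/

/-- A probability density `0 ≤ a ∈ L¹(ℝ) ∩ L^∞(ℝ)`. -/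
structure IsKernel (a : ℝ → ℝ) : Prop where
  nonneg : ∀ᵐ x : ℝ, 0 ≤ a x
  integrable : Integrable a
  essBounded : MemLp a ∞
  integral_eq_one : ∫ x, a x = 1

/-- `w : ℝ₊ → E` is a classical solution of `∂w/∂t = ϰ a * w - m w`, `w(0) = u₀`: it is continuous
on `[0, ∞)` and continuously differentiable on `(0, ∞)`, in the norm of `E = L^∞(ℝ)`
(values at negative times are irrelevant). -/
structure IsLinearSolution (ϰ m : ℝ) (a : ℝ → ℝ) (u₀ : Lp ℝ ∞ (volume : Measure ℝ))
    (w : ℝ → Lp ℝ ∞ (volume : Measure ℝ)) : Prop where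
  continuousOn : ContinuousOn w (Ici 0)
  differentiableAt : ∀ t, 0 < t → DifferentiableAt ℝ w t
  deriv_continuousOn : ContinuousOn (deriv w) (Ioi 0)
  equation : ∀ t, 0 < t →
    ∀ᵐ x : ℝ, deriv w t x = ϰ * (∫ y, a (x - y) * w t y) - m * w t x
  initial : w 0 = u₀

/-- Condition (C1): `u₀(x) → 0` as `x → ±∞` (up to null sets). -/
def CondC1 (u₀ : ℝ → ℝ) : Prop :=
  Tendsto u₀ (atTop ⊓ ae volume) (𝓝 0) ∧ Tendsto u₀ (atBot ⊓ ae volume) (𝓝 0)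

/-- Condition (C2): `u₀(x) → 0` as `x → ∞`, and `u₀` is separated from `0` near `-∞`
(up to null sets). -/
def CondC2 (u₀ : ℝ → ℝ) : Prop :=
  Tendsto u₀ (atTop ⊓ ae volume) (𝓝 0) ∧
    ∃ ρ : ℝ, 0 ≤ ρ ∧ ∃ c : ℝ, 0 < c ∧ ∀ᵐ x : ℝ, x ≤ -ρ → c ≤ u₀ x

/-- `u₀ ≢ 0`, in the sense that `u₀ ≥ δ > 0` a.e. on some interval. -/
def NontrivialInit (u₀ : ℝ → ℝ) : Prop :=
  ∃ δ ρ x₀ : ℝ, 0 < δ ∧ 0 < ρ ∧ ∀ᵐ x : ℝ, x ∈ Icc (x₀ - ρ) (x₀ + ρ) → δ ≤ u₀ x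

/-- `Λ_ε⁺(t, b)` for `b ∈ S(ℝ)`. -/
noncomputable def LambdaS (β ε : ℝ) (b : ℝ → ℝ) (t : ℝ) : Set ℝ :=
  Icc (-leftFront β b (t + ε * t)) (rightFront β b (t + ε * t))

/-- `Λ_ε⁺(t, b)` for `b ∈ MS(ℝ)`. -/
noncomputable def LambdaMS (β ε : ℝ) (b : ℝ → ℝ) (t : ℝ) : Set ℝ :=
  Iic (rightFront β b (t + ε * t))

/-! ## Positive operators and the linear evolution equation -/

/-! Write `A f = a * f`, a positive bounded operator on `L^∞`. Then `w(t) = e^{-mt} exp(ϰtA) u₀`,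
and summing the exponential series term by term gives a comparison principle: if a bounded `φ ≥ 0`
satisfies `A φ ≤ (1 + δ) φ` and `u₀ ≤ C φ`, then `w(t) ≤ C e^{(β + ϰδ)t} φ`. If also `φ ≤ b` in the
tails, then outside `Λ_ε⁺(t, b)`, where eventually `b ≤ e^{-β(1+ε)t}`, the choice `ϰδ = βε/2` gives
`w(t) ≤ C e^{-βεt/2}`. Everything reduces to finding `φ` for each `δ > 0`
(`IsLinearSolution.tendsto_essSup_compl`).

Take for `φ` the function `b` flattened at a low level `lam` (`cutoff`). Where `φ = lam` the
inequality is trivial, since `φ ≤ lam` and `a` has integral one. The remaining points are far out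
when `lam` is small, and there `∫ φ(x - y) a(y) dy` is split at `y = K` and `y = x - K`. For `y ≤
K`, long-tailedness gives at most `(1 + δ/2) b(x)`. The middle is negligible relative to `b(x)`
(`ConvMiddleSmall`). For `y ≥ x - K` the kernel contributes `O(b(x))`, multiplied by `∫ φ` for
`S(ℝ)` or by `lam` for `MS(ℝ)`; either factor becomes small with `lam`.

Smallness of the middle is where sub-exponentiality enters: the convolution square of `b` is
asymptotically `2Bb(x)`, where `B` is the total mass, and its two ends already account for nearly
all of this. Domination of the kernel or its tail by `b`, with Fubini in the latter case, transfers
the estimate to the kernel. -/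

instance Lp.instPosSMulMonoReal {α : Type*} {_ : MeasurableSpace α} {μ : Measure α} {p : ℝ≥0∞} :
    PosSMulMono ℝ (Lp ℝ p μ) where
  smul_le_smul_of_nonneg_left c hc f g hfg := by
    rw [← Lp.coeFn_le] at hfg ⊢
    filter_upwards [hfg, Lp.coeFn_smul c f, Lp.coeFn_smul c g] with x h hf hg
    rw [hf, hg]
    exact mul_le_mul_of_nonneg_left h hc

section Evolution

variable {E : Type*} [NormedAddCommGroup E] [NormedSpace ℝ E] [CompleteSpace E]

/-- A solution of `w' = ϰ T w - m w` is given by the exponential of `T`. -/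
theorem eq_exp_of_deriv_eq {T : E →L[ℝ] E} {ϰ m : ℝ} {w : ℝ → E} {u₀ : E}
    (hc : ContinuousOn w (Ici 0)) (hd : ∀ t, 0 < t → DifferentiableAt ℝ w t)
    (he : ∀ t, 0 < t → deriv w t = ϰ • T (w t) - m • w t) (h0 : w 0 = u₀) {t : ℝ} (ht : 0 ≤ t) :
    w t = Real.exp (-(m * t)) • NormedSpace.exp ((ϰ * t) • T) u₀ := by
  -- Integrating factor: `V` has zero derivative, and `V 0 = u₀`.
  set V : ℝ → E := fun s => Real.exp (m * s) • NormedSpace.exp ((-s) • (ϰ • T)) (w s) with hV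
  have hexp : ∀ s : ℝ, HasDerivAt (fun s : ℝ => NormedSpace.exp ((-s) • (ϰ • T)))
      (-(NormedSpace.exp ((-s) • (ϰ • T)) * (ϰ • T))) s := fun s => by
    have h := (hasDerivAt_exp_smul_const (𝕂 := ℝ) (ϰ • T) (-s)).scomp s (hasDerivAt_neg s)
    rw [neg_one_smul] at h
    exact h
  have hVd : ∀ s, 0 < s → HasDerivAt V 0 s := fun s hs => by
    have h1 := (hexp s).clm_apply (hd s hs).hasDerivAt
    have h2 : HasDerivAt (fun s : ℝ => Real.exp (m * s)) (Real.exp (m * s) * m) s := by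
      simpa using ((hasDerivAt_id s).const_mul m).exp
    have h3 := h2.smul h1
    refine h3.congr_deriv ?_
    rw [he s hs]
    simp only [map_sub, map_smul, neg_apply, mul_apply_eq_comp,
      smul_apply, smul_sub, smul_add, smul_neg, smul_smul]
    abel
  have hVc : ContinuousOn V (Ici 0) := by
    refine ContinuousOn.smul (by fun_prop) ?_
    refine ContinuousOn.clm_apply (fun s _ => (hexp s).continuousAt.continuousWithinAt) hc
  have hconst : V t = V 0 := by
    rcases ht.eq_or_lt with rfl | htp
    · rfl
    -- The equation holds only for positive times, so constancy is obtained on `(0, t]` and carried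
    -- to `0` by continuity.
    have hon : ∀ s ∈ Ioc 0 t, V s = V t := fun s hs => by
      refine (constant_of_has_deriv_right_zero (f := V) (a := s) (b := t)
        (hVc.mono fun x hx => hs.1.le.trans hx.1)
        (fun x hx => (hVd x (hs.1.trans_le hx.1)).hasDerivWithinAt) t ⟨hs.2, le_rfl⟩).symm
    have hlim : Tendsto V (𝓝[>] 0) (𝓝 (V 0)) :=
      (hVc 0 self_mem_Ici).mono_left (nhdsWithin_mono _ Ioi_subset_Ici_self)
    refine tendsto_nhds_unique (tendsto_const_nhds.congr' ?_) hlim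
    filter_upwards [Ioc_mem_nhdsGT htp] with s hs using (hon s hs).symm
  have hV0 : V 0 = u₀ := by simp [hV, h0]
  rw [hV0] at hconst
  have hcomm : Commute ((ϰ * t) • T) ((-t) • (ϰ • T)) :=
    (((Commute.refl T).smul_right ϰ).smul_right (-t)).smul_left (ϰ * t)
  have hinv : NormedSpace.exp ((ϰ * t) • T) * NormedSpace.exp ((-t) • (ϰ • T)) = 1 := by
    let _ : NormedAlgebra ℚ (E →L[ℝ] E) := NormedAlgebra.restrictScalars ℚ ℝ _
    rw [← NormedSpace.exp_add_of_commute hcomm, smul_smul, ← add_smul]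
    simp [mul_comm]
  rw [← hconst, hV]
  have happ : NormedSpace.exp ((ϰ * t) • T) (NormedSpace.exp ((-t) • (ϰ • T)) (w t)) = w t := by
    rw [← mul_apply_eq_comp, hinv, one_apply_eq_self]
  rw [map_smul, smul_smul, ← Real.exp_add, happ]
  simp

/-- If a positive operator satisfies `T φ ≤ q φ`, then `u ≤ C φ` implies
`exp (s T) u ≤ C e^{sq} φ`. -/
theorem exp_smul_apply_le [PartialOrder E] [IsOrderedAddMonoid E] [PosSMulMono ℝ E]
    [OrderClosedTopology E] {T : E →L[ℝ] E} (hT : ∀ f g, f ≤ g → T f ≤ T g) {φ u : E} {q C s : ℝ}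
    (hC : 0 ≤ C) (hs : 0 ≤ s) (hq : 0 ≤ q) (hφ : T φ ≤ q • φ) (hu : u ≤ C • φ) :
    NormedSpace.exp (s • T) u ≤ (C * Real.exp (s * q)) • φ := by
  -- Positivity allows `T φ ≤ q φ` to be iterated; the bounds are then summed along the exponential
  -- series, as the order is closed.
  have hpow : ∀ n : ℕ, (T ^ n) u ≤ (C * q ^ n) • φ := fun n => by
    induction n with
    | zero => simpa using hu
    | succ n ih =>
      rw [pow_succ', mul_apply_eq_comp]
      calc T ((T ^ n) u) ≤ T ((C * q ^ n) • φ) := hT _ _ ih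
        _ = (C * q ^ n) • T φ := map_smul _ _ _
        _ ≤ (C * q ^ n) • (q • φ) := smul_le_smul_of_nonneg_left hφ (by positivity)
        _ = (C * q ^ (n + 1)) • φ := by rw [smul_smul]; ring_nf
  have h1 : HasSum (fun n : ℕ => ((n.factorial : ℝ)⁻¹ • (s • T) ^ n) u)
      (NormedSpace.exp (s • T) u) :=
    (NormedSpace.exp_series_hasSum_exp' (𝕂 := ℝ) (s • T)).mapL
      (ContinuousLinearMap.apply ℝ E u)
  have h2 : HasSum (fun n : ℕ => (C * ((n.factorial : ℝ)⁻¹ • (s * q) ^ n)) • φ)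
      ((C * Real.exp (s * q)) • φ) := by
    have := NormedSpace.exp_series_hasSum_exp' (𝕂 := ℝ) (s * q)
    rw [← Real.exp_eq_exp_ℝ] at this
    exact (this.mul_left C).smul_const φ
  refine hasSum_le (fun n => ?_) h1 h2
  rw [smul_pow, smul_apply, smul_apply, smul_smul]
  refine (smul_le_smul_of_nonneg_left (hpow n) (by positivity)).trans_eq ?_
  rw [smul_smul, smul_eq_mul, mul_pow]
  ring_nf

end Evolution

/-! ## Convolution with an integrable kernel on `L^∞` -/

theorem Lp.ae_abs_le_norm (f : Lp ℝ ∞ (volume : Measure ℝ)) : ∀ᵐ x : ℝ, |f x| ≤ ‖f‖ := by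
  have h := ae_le_eLpNormEssSup (f := f) (μ := (volume : Measure ℝ))
  have hlt : eLpNormEssSup f (volume : Measure ℝ) ≠ ∞ := by
    rw [← eLpNorm_exponent_top]; exact Lp.eLpNorm_ne_top f
  filter_upwards [h] with x hx
  rw [Lp.norm_def, eLpNorm_exponent_top, ← Real.norm_eq_abs, ← toReal_enorm]
  exact ENNReal.toReal_mono hlt hx

theorem integrable_mul_bounded {a : ℝ → ℝ} (ha : Integrable a) {f : ℝ → ℝ}
    (hf : AEStronglyMeasurable f) {C : ℝ} (hC : ∀ᵐ x, |f x| ≤ C) (x : ℝ) :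
    Integrable (fun y => a (x - y) * f y) :=
  (ha.comp_sub_left x).mul_bdd hf (by simpa using hC)

theorem abs_integral_conv_le {a : ℝ → ℝ} (ha : Integrable a) {f : ℝ → ℝ}
    {C : ℝ} (hC : ∀ᵐ x, |f x| ≤ C) (x : ℝ) :
    |∫ y, a (x - y) * f y| ≤ (∫ y, |a y|) * C := by
  rw [← integral_sub_left_eq_self (fun y => |a y|) volume x, ← integral_mul_const]
  refine norm_integral_le_of_norm_le (f := fun y => a (x - y) * f y)
    ((ha.comp_sub_left x).abs.mul_const C) ?_
  filter_upwards [hC] with y hy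
  rw [Real.norm_eq_abs, abs_mul]
  exact mul_le_mul_of_nonneg_left hy (abs_nonneg _)

theorem memLp_top_conv {a : ℝ → ℝ} (ha : Integrable a) (f : Lp ℝ ∞ (volume : Measure ℝ)) :
    MemLp (fun x => ∫ y, a (x - y) * f y) ∞ := by
  refine memLp_top_of_bound ?_ _ (ae_of_all _ (abs_integral_conv_le ha (Lp.ae_abs_le_norm f)))
  have := ((Lp.aestronglyMeasurable f).convolution_integrand (ContinuousLinearMap.mul ℝ ℝ)
    ha.aestronglyMeasurable).integral_prod_right'
  simpa [mul_comm] using this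

/-- The operator `f ↦ a * f` on `L^∞`. -/
noncomputable def convLinfty (a : ℝ → ℝ) (ha : Integrable a) :
    Lp ℝ ∞ (volume : Measure ℝ) →L[ℝ] Lp ℝ ∞ (volume : Measure ℝ) :=
  LinearMap.mkContinuous
    { toFun := fun f => (memLp_top_conv ha f).toLp
      map_add' := fun f g => by
        rw [← MemLp.toLp_add]
        refine MemLp.toLp_congr _ _ (ae_of_all _ fun x => ?_)
        rw [Pi.add_apply, ← integral_add
          (integrable_mul_bounded ha (Lp.aestronglyMeasurable f) (Lp.ae_abs_le_norm f) x)
          (integrable_mul_bounded ha (Lp.aestronglyMeasurable g) (Lp.ae_abs_le_norm g) x)]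
        refine integral_congr_ae ?_
        filter_upwards [Lp.coeFn_add f g] with y hy
        rw [hy, Pi.add_apply, mul_add]
      map_smul' := fun c f => by
        rw [RingHom.id_apply, ← MemLp.toLp_const_smul]
        refine MemLp.toLp_congr _ _ (ae_of_all _ fun x => ?_)
        rw [Pi.smul_apply, smul_eq_mul, ← integral_const_mul]
        refine integral_congr_ae ?_
        filter_upwards [Lp.coeFn_smul c f] with y hy
        rw [hy, Pi.smul_apply, smul_eq_mul]
        ring }
    (∫ y, |a y|) fun f => by
      simp only [LinearMap.coe_mk, AddHom.coe_mk]
      rw [Lp.norm_toLp, eLpNorm_exponent_top]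
      have h0 : 0 ≤ (∫ y, |a y|) * ‖f‖ := by positivity
      refine ENNReal.toReal_le_of_le_ofReal h0 (eLpNormEssSup_le_of_ae_bound (ae_of_all _ fun x => ?_))
      exact abs_integral_conv_le ha (Lp.ae_abs_le_norm f) x

theorem convLinfty_coeFn {a : ℝ → ℝ} (ha : Integrable a) (f : Lp ℝ ∞ (volume : Measure ℝ)) :
    convLinfty a ha f =ᵐ[volume] fun x => ∫ y, a (x - y) * f y :=
  MemLp.coeFn_toLp (memLp_top_conv ha f)

theorem ae_comp_sub_left {p : ℝ → Prop} (h : ∀ᵐ x, p x) (x : ℝ) : ∀ᵐ y, p (x - y) :=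
  (Measure.measurePreserving_sub_left volume x).quasiMeasurePreserving.ae h

theorem convLinfty_mono {a : ℝ → ℝ} (ha : Integrable a) (ha0 : ∀ᵐ x, 0 ≤ a x)
    {f g : Lp ℝ ∞ (volume : Measure ℝ)} (h : f ≤ g) : convLinfty a ha f ≤ convLinfty a ha g := by
  rw [← Lp.coeFn_le] at h ⊢
  filter_upwards [convLinfty_coeFn ha f, convLinfty_coeFn ha g] with x hf hg
  rw [hf, hg]
  refine integral_mono_ae
    (integrable_mul_bounded ha (Lp.aestronglyMeasurable f) (Lp.ae_abs_le_norm f) x)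
    (integrable_mul_bounded ha (Lp.aestronglyMeasurable g) (Lp.ae_abs_le_norm g) x) ?_
  filter_upwards [h, ae_comp_sub_left ha0 x] with y hy hay
  exact mul_le_mul_of_nonneg_left hy hay

theorem IsLinearSolution.eq_exp {ϰ m : ℝ} {a : ℝ → ℝ} (ha : Integrable a)
    {u₀ : Lp ℝ ∞ (volume : Measure ℝ)} {w : ℝ → Lp ℝ ∞ (volume : Measure ℝ)}
    (hw : IsLinearSolution ϰ m a u₀ w) {t : ℝ} (ht : 0 ≤ t) :
    w t = Real.exp (-(m * t)) • NormedSpace.exp ((ϰ * t) • convLinfty a ha) u₀ := by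
  refine eq_exp_of_deriv_eq hw.continuousOn hw.differentiableAt (fun t ht => ?_) hw.initial ht
  refine Lp.ext ?_
  filter_upwards [hw.equation t ht, convLinfty_coeFn ha (w t),
    Lp.coeFn_sub (ϰ • convLinfty a ha (w t)) (m • w t),
    Lp.coeFn_smul ϰ (convLinfty a ha (w t)), Lp.coeFn_smul m (w t)] with x h1 h2 h3 h4 h5
  rw [h1, h3, Pi.sub_apply, h4, h5, Pi.smul_apply, Pi.smul_apply, h2, smul_eq_mul, smul_eq_mul]

/-- Comparison of a solution of the linear equation with a supersolution `e^{ct} φ`. -/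
theorem IsLinearSolution.ae_le {ϰ m : ℝ} (hϰ : 0 ≤ ϰ) {a : ℝ → ℝ} (ha : IsKernel a)
    {u₀ : Lp ℝ ∞ (volume : Measure ℝ)} {w : ℝ → Lp ℝ ∞ (volume : Measure ℝ)}
    (hw : IsLinearSolution ϰ m a u₀ w) {φ : ℝ → ℝ} (hφm : AEStronglyMeasurable φ) {B : ℝ}
    (hφB : ∀ x, |φ x| ≤ B) {C q : ℝ} (hC : 0 ≤ C) (hq : 0 ≤ q)
    (hsup : ∀ᵐ x, ∫ y, a (x - y) * φ y ≤ q * φ x) (hu : ∀ᵐ x, u₀ x ≤ C * φ x)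
    {t : ℝ} (ht : 0 ≤ t) :
    ∀ᵐ x, w t x ≤ C * Real.exp ((ϰ * q - m) * t) * φ x := by
  have hint := ha.integrable
  have hφL : MemLp φ ∞ (volume : Measure ℝ) := memLp_top_of_bound hφm B (ae_of_all _ hφB)
  have hT : ∀ f g, f ≤ g → convLinfty a hint f ≤ convLinfty a hint g :=
    fun f g => convLinfty_mono hint ha.nonneg
  have hφ1 : convLinfty a hint hφL.toLp ≤ q • hφL.toLp := by
    rw [← Lp.coeFn_le]
    filter_upwards [convLinfty_coeFn hint hφL.toLp, Lp.coeFn_smul q hφL.toLp, hφL.coeFn_toLp,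
      hsup] with x h1 h2 h3 h4
    rw [h1, h2, Pi.smul_apply, h3, smul_eq_mul]
    refine le_of_eq_of_le (integral_congr_ae ?_) h4
    filter_upwards [hφL.coeFn_toLp] with y hy
    rw [hy]
  have hu1 : u₀ ≤ C • hφL.toLp := by
    rw [← Lp.coeFn_le]
    filter_upwards [hu, Lp.coeFn_smul C hφL.toLp, hφL.coeFn_toLp] with x h1 h2 h3
    rw [h2, Pi.smul_apply, h3, smul_eq_mul]
    exact h1
  have hle : w t ≤ (C * Real.exp ((ϰ * q - m) * t)) • hφL.toLp := by
    rw [hw.eq_exp hint ht]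
    refine (smul_le_smul_of_nonneg_left (exp_smul_apply_le hT hC (mul_nonneg hϰ ht) hq hφ1 hu1)
      (Real.exp_pos _).le).trans_eq ?_
    rw [smul_smul, mul_left_comm, ← Real.exp_add]
    ring_nf
  rw [← Lp.coeFn_le] at hle
  filter_upwards [hle, Lp.coeFn_smul (C * Real.exp ((ϰ * q - m) * t)) hφL.toLp,
    hφL.coeFn_toLp] with x h1 h2 h3
  rw [h2, Pi.smul_apply, h3, smul_eq_mul] at h1
  exact h1

/-- Positivity of the exponential is the comparison bound for `-u₀` with `φ = 0`. -/
theorem IsLinearSolution.ae_nonneg {ϰ m : ℝ} (hϰ : 0 ≤ ϰ) {a : ℝ → ℝ} (ha : IsKernel a)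
    {u₀ : Lp ℝ ∞ (volume : Measure ℝ)} (hu₀ : ∀ᵐ x : ℝ, 0 ≤ u₀ x)
    {w : ℝ → Lp ℝ ∞ (volume : Measure ℝ)} (hw : IsLinearSolution ϰ m a u₀ w)
    {t : ℝ} (ht : 0 ≤ t) : ∀ᵐ x, 0 ≤ w t x := by
  have h := exp_smul_apply_le (T := convLinfty a ha.integrable) (φ := 0) (u := -u₀) (q := 0)
    (C := 0) (s := ϰ * t) (fun f g => convLinfty_mono ha.integrable ha.nonneg) le_rfl
    (mul_nonneg hϰ ht) le_rfl (by simp) (by simpa using (Lp.coeFn_nonneg u₀).1 hu₀)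
  have h0 : 0 ≤ w t := by
    rw [hw.eq_exp ha.integrable ht]
    refine smul_nonneg (Real.exp_pos _).le ?_
    simpa using h
  exact (Lp.coeFn_nonneg (w t)).2 h0

/-! ## Long tails and the middle part of a convolution -/

theorem LongTailed.eventually_le_mul {b : ℝ → ℝ} (hb : LongTailed b) {K q : ℝ} (hK : 0 ≤ K)
    (hq : 1 < q) : ∀ᶠ x in atTop, b (x - K) ≤ q * b x := by
  obtain ⟨⟨ρ, -, hpos⟩, hlim⟩ := hb
  have h1 := (tendsto_atTop_add_const_right atTop (-K) tendsto_id).eventually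
    ((hlim K hK).eventually_const_lt (inv_lt_one_of_one_lt₀ hq))
  filter_upwards [h1, eventually_ge_atTop (ρ + K)] with x hx hxρ
  simp only [id, ← sub_eq_add_neg, sub_add_cancel] at hx
  have hp : 0 < b (x - K) := hpos _ (by linarith)
  rw [lt_div_iff₀ hp, inv_mul_lt_iff₀ (by linarith)] at hx
  exact hx.le

theorem LongTailed.eventually_le_mul_add {b : ℝ → ℝ} (hb : LongTailed b) {K q : ℝ} (hK : 0 ≤ K)
    (hq : 1 < q) : ∀ᶠ x in atTop, b x ≤ q * b (x + K) := by
  have h := (tendsto_atTop_add_const_right atTop K tendsto_id).eventually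
    (hb.eventually_le_mul hK hq)
  simpa using h

theorem LongTailed.eventually_pos {b : ℝ → ℝ} (hb : LongTailed b) : ∀ᶠ x in atTop, 0 < b x := by
  obtain ⟨⟨ρ, -, hpos⟩, -⟩ := hb
  filter_upwards [eventually_ge_atTop ρ] with x hx using hpos x hx

/-- The middle part of the convolution of `b` with `ν` is negligible with respect to `b`. -/
def ConvMiddleSmall (ν : Measure ℝ) (b : ℝ → ℝ) : Prop :=
  ∀ δ : ℝ, 0 < δ → ∀ᶠ K in atTop, ∀ᶠ x in atTop,
    ∫⁻ y in Ioo K (x - K), ENNReal.ofReal (b (x - y)) ∂ν ≤ ENNReal.ofReal (δ * b x)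

theorem intervalIntegrable_conv_self {b : ℝ → ℝ} (hi : IntegrableOn b (Ioi 0)) {M : ℝ}
    (hM : ∀ x, |b x| ≤ M) {x : ℝ} (hx : 0 ≤ x) :
    IntervalIntegrable (fun y => b (x - y) * b y) volume 0 x := by
  have h1 : IntervalIntegrable b volume 0 x :=
    (intervalIntegrable_iff_integrableOn_Ioc_of_le hx).2 (hi.mono_set fun y hy => hy.1)
  have h2 : IntervalIntegrable (fun y => b (x - y)) volume 0 x := by
    simpa using (h1.comp_sub_left x).symm
  rw [intervalIntegrable_iff] at *
  exact h2.mul_bdd (c := M) h1.aestronglyMeasurable (ae_of_all _ fun y => by simpa using hM y)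

theorem SubexpDensity.integrableOn {b : ℝ → ℝ} (hb : SubexpDensity b) : IntegrableOn b (Ioi 0) :=
  memLp_one_iff_integrable.1 hb.integrable

/-- The whole integral over `[0, x]` is at most `(2B + δ/2) b(x)`. The ends `[0, K]` and `[x - K,
x]` contribute equally under `y ↦ x - y`, and each is at least `(B - δ/4) b(x)` because `b(x - y) ≥
b(x)` on the first. Subtraction leaves `δ b(x)`. -/
theorem SubexpDensity.integral_middle_le {b : ℝ → ℝ} (hb : SubexpDensity b) (h0 : ∀ x, 0 ≤ b x)
    {M : ℝ} (hM : ∀ x, b x ≤ M) {ρ : ℝ} (hanti : AntitoneOn b (Ioi ρ)) {δ : ℝ} (hδ : 0 < δ) :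
    ∀ᶠ K in atTop, ∀ᶠ x in atTop, ∫ y in K..(x - K), b (x - y) * b y ≤ δ * b x := by
  have hint := hb.integrableOn
  have hMabs : ∀ x, |b x| ≤ M := fun x => by rw [abs_of_nonneg (h0 x)]; exact hM x
  set B := ∫ y in Ioi (0 : ℝ), b y with hB
  have hB0 : 0 ≤ B := setIntegral_nonneg measurableSet_Ioi fun y _ => h0 y
  have hK1 := (intervalIntegral_tendsto_integral_Ioi 0 hint tendsto_id).eventually_const_lt
    (show B - δ / 4 < B by linarith)
  -- The error `2B b(x) δ/(4B + 1)` is at most `(δ/2) b(x)`; the `+ 1` avoids having to know `B >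
  -- 0`.
  have hconv := hb.conv_equiv.isLittleO.bound (show 0 < δ / (4 * B + 1) by positivity)
  filter_upwards [hK1, eventually_gt_atTop 0] with K hK hK0
  simp only [id] at hK
  filter_upwards [hconv, eventually_gt_atTop (2 * K), eventually_gt_atTop (ρ + K)] with x hx hx2 hxρ
  have hII := intervalIntegrable_conv_self hint hMabs (show 0 ≤ x by linarith)
  have i1 : IntervalIntegrable (fun y => b (x - y) * b y) volume 0 K :=
    hII.mono_set (by rw [uIcc_of_le hK0.le, uIcc_of_le (by linarith)]; exact Icc_subset_Icc le_rfl (by linarith))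
  have i2 : IntervalIntegrable (fun y => b (x - y) * b y) volume K (x - K) :=
    hII.mono_set (by
      rw [uIcc_of_le (by linarith), uIcc_of_le (by linarith)]
      exact Icc_subset_Icc (by linarith) (by linarith))
  have i3 : IntervalIntegrable (fun y => b (x - y) * b y) volume (x - K) x :=
    hII.mono_set (by
      rw [uIcc_of_le (by linarith), uIcc_of_le (by linarith)]
      exact Icc_subset_Icc (by linarith) (by linarith))
  have hsplit := intervalIntegral.integral_add_adjacent_intervals i1 i2
  have hsplit2 := intervalIntegral.integral_add_adjacent_intervals (i1.trans i2) i3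
  have hthird : ∫ y in (x - K)..x, b (x - y) * b y = ∫ y in 0..K, b (x - y) * b y := by
    have h := intervalIntegral.integral_comp_sub_left (a := 0) (b := K)
      (fun y => b (x - y) * b y) x
    rw [sub_zero] at h
    rw [← h]
    refine intervalIntegral.integral_congr fun y _ => ?_
    simp [mul_comm]
  have hfirst : b x * ∫ y in 0..K, b y ≤ ∫ y in 0..K, b (x - y) * b y := by
    rw [← intervalIntegral.integral_const_mul]
    refine intervalIntegral.integral_mono_on hK0.le ?_ i1 fun y hy => ?_
    · exact ((intervalIntegrable_iff_integrableOn_Ioc_of_le hK0.le).2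
        (hint.mono_set fun y hy => hy.1)).const_mul _
    · refine mul_le_mul_of_nonneg_right (hanti ?_ ?_ ?_) (h0 y)
      · simp only [mem_Ioi]; linarith [hy.2]
      · simp only [mem_Ioi]; linarith [hy.2]
      · linarith [hy.1]
  have hup : ∫ y in (0 : ℝ)..x, b (x - y) * b y ≤ (2 * B + δ / 2) * b x := by
    simp only [Pi.sub_apply, Real.norm_eq_abs] at hx
    have h1 := (le_abs_self _).trans hx
    rw [abs_of_nonneg (mul_nonneg (by positivity) (h0 x))] at h1
    have h2 : δ / (4 * B + 1) * (2 * B * b x) ≤ δ / 2 * b x := by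
      rw [← mul_assoc]
      refine mul_le_mul_of_nonneg_right ?_ (h0 x)
      rw [div_mul_eq_mul_div, div_le_div_iff₀ (by positivity) (by norm_num)]
      nlinarith
    linarith
  have hlow : b x * (B - δ / 4) ≤ b x * ∫ y in 0..K, b y :=
    mul_le_mul_of_nonneg_left hK.le (h0 x)
  nlinarith

theorem SubexpDensity.lintegral_middle_le {b : ℝ → ℝ} (hb : SubexpDensity b) (h0 : ∀ x, 0 ≤ b x)
    {M : ℝ} (hM : ∀ x, b x ≤ M) {ρ : ℝ} (hanti : AntitoneOn b (Ioi ρ)) {δ : ℝ} (hδ : 0 < δ) :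
    ∀ᶠ K in atTop, ∀ᶠ x in atTop,
      ∫⁻ y in Ioo K (x - K), ENNReal.ofReal (b (x - y)) * ENNReal.ofReal (b y) ≤
        ENNReal.ofReal (δ * b x) := by
  have hMabs : ∀ x, |b x| ≤ M := fun x => by rw [abs_of_nonneg (h0 x)]; exact hM x
  filter_upwards [hb.integral_middle_le h0 hM hanti hδ, eventually_gt_atTop 0] with K hK hK0
  filter_upwards [hK, eventually_gt_atTop (2 * K)] with x hx hx2
  have hII := intervalIntegrable_conv_self hb.integrableOn hMabs (show 0 ≤ x by linarith)
  have hion : IntegrableOn (fun y => b (x - y) * b y) (Ioo K (x - K)) :=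
    ((intervalIntegrable_iff_integrableOn_Ioc_of_le (by linarith)).1 hII).mono_set
      fun y hy => ⟨hK0.trans hy.1, by linarith [hy.2]⟩
  rw [intervalIntegral.integral_of_le (by linarith), integral_Ioc_eq_integral_Ioo] at hx
  refine le_trans (le_of_eq ?_) (ENNReal.ofReal_le_ofReal hx)
  rw [ofReal_integral_eq_lintegral_ofReal hion (ae_of_all _ fun y => mul_nonneg (h0 _) (h0 _))]
  simp_rw [ENNReal.ofReal_mul (h0 _)]

theorem setLIntegral_withDensity_ofReal {a : ℝ → ℝ} (ha : AEMeasurable a) (g : ℝ → ℝ≥0∞)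
    {s : Set ℝ} (hs : MeasurableSet s) :
    ∫⁻ y in s, g y ∂(volume.withDensity fun y => ENNReal.ofReal (a y)) =
      ∫⁻ y in s, ENNReal.ofReal (a y) * g y :=
  setLIntegral_withDensity_eq_setLIntegral_mul_non_measurable₀ _ ha.ennreal_ofReal.restrict g hs
    (ae_of_all _ fun _ => ENNReal.ofReal_lt_top)

/-- Density case, kernel dominated by `b`. -/
theorem SubexpDensity.convMiddleSmall_of_le {b : ℝ → ℝ} (hb : SubexpDensity b)
    (h0 : ∀ x, 0 ≤ b x) {M : ℝ} (hM : ∀ x, b x ≤ M) {ρ : ℝ} (hanti : AntitoneOn b (Ioi ρ))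
    {a : ℝ → ℝ} (ha : AEMeasurable a) {ρ' : ℝ} (hab : ∀ᵐ x, ρ' < x → a x ≤ b x) :
    ConvMiddleSmall (volume.withDensity fun y => ENNReal.ofReal (a y)) b := by
  intro δ hδ
  filter_upwards [hb.lintegral_middle_le h0 hM hanti hδ, eventually_gt_atTop ρ'] with K hK hKρ
  filter_upwards [hK] with x hx
  rw [setLIntegral_withDensity_ofReal ha _ measurableSet_Ioo]
  refine le_trans (lintegral_mono_ae ?_) hx
  filter_upwards [ae_restrict_mem measurableSet_Ioo, ae_restrict_of_ae hab] with y hy hay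
  rw [mul_comm]
  exact mul_le_mul_right (ENNReal.ofReal_le_ofReal (hay (hKρ.trans hy.1))) _

/-- Density case, tails of the measure dominated by `b`. -/
theorem SubexpDensity.convMiddleSmall_of_tail_le {b : ℝ → ℝ} (hb : SubexpDensity b)
    (h0 : ∀ x, 0 ≤ b x) {M : ℝ} (hM : ∀ x, b x ≤ M) (hanti : Antitone b)
    {ν : Measure ℝ} [IsFiniteMeasure ν]
    (hν : ∀ᶠ z in atTop, ν (Ici z) ≤ ENNReal.ofReal (2 * b z)) :
    ConvMiddleSmall ν b := by
  intro δ hδ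
  obtain ⟨Z, hZ⟩ := eventually_atTop.1
    (hν.and (hb.longTailed.eventually_le_mul_add zero_le_one (q := 2) (by norm_num)))
  -- Smearing by one unit below enlarges `(K, x - K)` to `(K - 1, x - (K - 1))`; `δ/4` absorbs two
  -- factors of `2`, from long-tailedness and from the tail of `ν`.
  have hmid := (tendsto_atTop_add_const_right atTop (-1) tendsto_id).eventually
    (hb.lintegral_middle_le h0 hM (hanti.antitoneOn (Ioi 0)) (show 0 < δ / 4 by positivity))
  filter_upwards [hmid, eventually_ge_atTop (Z + 1)] with K hK hKZ
  filter_upwards [hK] with x hx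
  simp only [id] at hx
  -- `b(x - y) ≤ 2 b(x - y + 1) ≤ 2 ∫ b(x - z) dz` over `z ∈ [y - 1, y)`. After Fubini, integration
  -- in `y` produces `ν [z, ∞) ≤ 2 b(z)`, hence the convolution square of `b`.
  set F : ℝ → ℝ → ℝ≥0∞ := fun y z =>
    {p : ℝ × ℝ | p.2 < p.1 ∧ p.1 ≤ p.2 + 1}.indicator (fun p => ENNReal.ofReal (b (x - p.2))) (y, z)
    with hF
  have hFm : Measurable (Function.uncurry F) := by
    refine Measurable.indicator ?_ ?_
    · exact (hanti.measurable.comp (by fun_prop)).ennreal_ofReal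
    · exact (measurableSet_lt measurable_snd measurable_fst).inter
        (measurableSet_le measurable_fst (by fun_prop))
  have h1 : ∀ y ∈ Ioo K (x - K), ENNReal.ofReal (b (x - y)) ≤ 2 * ∫⁻ z, F y z := fun y hy => by
    have hle : ∀ z ∈ Ico (y - 1) y, ENNReal.ofReal (b (x - y + 1)) ≤ F y z := fun z hz => by
      have hmem : (y, z) ∈ {p : ℝ × ℝ | p.2 < p.1 ∧ p.1 ≤ p.2 + 1} :=
        ⟨hz.2, by show y ≤ z + 1; linarith [hz.1]⟩
      simp only [hF, indicator_of_mem hmem]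
      exact ENNReal.ofReal_le_ofReal (hanti (by linarith [hz.1]))
    have h2 : ENNReal.ofReal (b (x - y + 1)) ≤ ∫⁻ z, F y z := by
      calc ENNReal.ofReal (b (x - y + 1))
          = ∫⁻ _ in Ico (y - 1) y, ENNReal.ofReal (b (x - y + 1)) := by simp
        _ ≤ ∫⁻ z in Ico (y - 1) y, F y z := setLIntegral_mono' measurableSet_Ico hle
        _ ≤ ∫⁻ z, F y z := setLIntegral_le_lintegral _ _
    refine le_trans ?_ (mul_le_mul_right h2 2)
    rw [← ENNReal.ofReal_ofNat 2, ← ENNReal.ofReal_mul (by norm_num)]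
    exact ENNReal.ofReal_le_ofReal (hZ (x - y) (by linarith [hy.2])).2
  have h2 : ∀ z, ∫⁻ y in Ioo K (x - K), F y z ∂ν ≤
      (Ioo (K - 1) (x - (K - 1))).indicator
        (fun z => 2 * (ENNReal.ofReal (b (x - z)) * ENNReal.ofReal (b z))) z := fun z => by
    by_cases hz : z ∈ Ioo (K - 1) (x - (K - 1))
    · rw [indicator_of_mem hz]
      calc ∫⁻ y in Ioo K (x - K), F y z ∂ν
          ≤ ∫⁻ y, F y z ∂ν := setLIntegral_le_lintegral _ _
        _ ≤ ∫⁻ y, (Ici z).indicator (fun _ => ENNReal.ofReal (b (x - z))) y ∂ν := by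
            refine lintegral_mono fun y => ?_
            simp only [hF, indicator_apply, mem_ofPred_eq, mem_Ici]
            split_ifs with h h' <;> first | exact le_rfl | exact zero_le | exact absurd h.1.le h'
        _ = ENNReal.ofReal (b (x - z)) * ν (Ici z) := by
            rw [lintegral_indicator_const measurableSet_Ici]
        _ ≤ ENNReal.ofReal (b (x - z)) * ENNReal.ofReal (2 * b z) :=
            mul_le_mul_right (hZ z (by linarith [hz.1])).1 _
        _ = 2 * (ENNReal.ofReal (b (x - z)) * ENNReal.ofReal (b z)) := by
            rw [ENNReal.ofReal_mul (by norm_num), ENNReal.ofReal_ofNat]; ring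
    · rw [indicator_of_notMem hz, nonpos_iff_eq_zero]
      refine setLIntegral_eq_zero measurableSet_Ioo fun y hy => ?_
      refine indicator_of_notMem (fun h => hz ⟨?_, ?_⟩) _
      · have : y ≤ z + 1 := h.2
        linarith [hy.1]
      · have : z < y := h.1
        linarith [hy.2]
  calc ∫⁻ y in Ioo K (x - K), ENNReal.ofReal (b (x - y)) ∂ν
      ≤ ∫⁻ y in Ioo K (x - K), (2 * ∫⁻ z, F y z) ∂ν := setLIntegral_mono' measurableSet_Ioo h1
    _ = 2 * ∫⁻ y in Ioo K (x - K), (∫⁻ z, F y z) ∂ν :=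
        lintegral_const_mul' _ _ (by simp)
    _ = 2 * ∫⁻ z, ∫⁻ y in Ioo K (x - K), F y z ∂ν := by
        rw [lintegral_lintegral_swap hFm.aemeasurable]
    _ ≤ 2 * ∫⁻ z, (Ioo (K - 1) (x - (K - 1))).indicator
        (fun z => 2 * (ENNReal.ofReal (b (x - z)) * ENNReal.ofReal (b z))) z :=
        mul_le_mul_right (lintegral_mono h2) _
    _ = 4 * ∫⁻ z in Ioo (K - 1) (x - (K - 1)),
          ENNReal.ofReal (b (x - z)) * ENNReal.ofReal (b z) := by
        rw [lintegral_indicator measurableSet_Ioo, lintegral_const_mul' _ _ (by simp), ← mul_assoc]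
        norm_num
    _ ≤ 4 * ENNReal.ofReal (δ / 4 * b x) := mul_le_mul_right (by simpa [sub_eq_add_neg] using hx) _
    _ = ENNReal.ofReal (δ * b x) := by
        rw [← ENNReal.ofReal_ofNat 4, ← ENNReal.ofReal_mul (by norm_num)]
        ring_nf

/-! ### Mass estimates for the Stieltjes measure of a decreasing function -/

section Stieltjes

variable {b : ℝ → ℝ} (hb : Antitone b)

theorem negStieltjes_fun_le {x y : ℝ} (hxy : x < y) :
    (Antitone.neg hb).stieltjesFunction x ≤ -b y :=
  (Antitone.neg hb).rightLim_le hxy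

theorem le_negStieltjes_fun (x : ℝ) : -b x ≤ (Antitone.neg hb).stieltjesFunction x :=
  (Antitone.neg hb).le_rightLim le_rfl

theorem negStieltjes_fun_tendsto (h0 : Tendsto b atTop (𝓝 0)) :
    Tendsto (Antitone.neg hb).stieltjesFunction atTop (𝓝 0) := by
  have h1 : Tendsto (fun x => -b x) atTop (𝓝 0) := by simpa using h0.neg
  have h2 : Tendsto (fun x => -b (x + 1)) atTop (𝓝 0) :=
    h1.comp (tendsto_atTop_add_const_right atTop 1 tendsto_id)
  exact tendsto_of_tendsto_of_tendsto_of_le_of_le h1 h2 (le_negStieltjes_fun hb)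
    fun x => negStieltjes_fun_le hb (lt_add_one x)

theorem isFiniteMeasure_negStieltjes (h0 : Tendsto b atTop (𝓝 0)) {M : ℝ} (hM : ∀ x, b x ≤ M) :
    IsFiniteMeasure (negStieltjes hb) := by
  have hbdd : BddBelow (range (Antitone.neg hb).stieltjesFunction) :=
    ⟨-M, by rintro _ ⟨x, rfl⟩; exact (neg_le_neg (hM x)).trans (le_negStieltjes_fun hb x)⟩
  refine ⟨?_⟩
  rw [negStieltjes, StieltjesFunction.measure_univ _
    (tendsto_atBot_ciInf (Antitone.neg hb).stieltjesFunction.mono hbdd)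
    (negStieltjes_fun_tendsto hb h0)]
  exact ENNReal.ofReal_lt_top

/-- The exact mass of `[z, ∞)` is the left limit `b(z-)`. This and the next two bounds replace
one-sided limits by values of `b`, at the price of unit shifts in the latter two; such shifts are
asymptotically harmless for a long-tailed `b`. -/
theorem ofReal_le_negStieltjes_Ici (h0 : Tendsto b atTop (𝓝 0)) (z : ℝ) :
    ENNReal.ofReal (b z) ≤ negStieltjes hb (Ici z) := by
  rw [negStieltjes, StieltjesFunction.measure_Ici _ (negStieltjes_fun_tendsto hb h0)]
  refine ENNReal.ofReal_le_ofReal ?_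
  rw [zero_sub, le_neg]
  refine le_of_tendsto ((Antitone.neg hb).stieltjesFunction.mono.tendsto_leftLim z) ?_
  filter_upwards [self_mem_nhdsWithin] with y hy
  exact negStieltjes_fun_le hb hy

theorem negStieltjes_Ici_le (h0 : Tendsto b atTop (𝓝 0)) (z : ℝ) :
    negStieltjes hb (Ici z) ≤ ENNReal.ofReal (b (z - 1)) := by
  rw [negStieltjes, StieltjesFunction.measure_Ici _ (negStieltjes_fun_tendsto hb h0)]
  refine ENNReal.ofReal_le_ofReal ?_
  rw [zero_sub, neg_le]
  exact (le_negStieltjes_fun hb _).trans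
    ((Antitone.neg hb).stieltjesFunction.mono.le_leftLim (sub_one_lt z))

theorem le_negStieltjes_Ioc (u v : ℝ) :
    ENNReal.ofReal (b (u + 1) - b v) ≤ negStieltjes hb (Ioc u v) := by
  rw [negStieltjes, StieltjesFunction.measure_Ioc]
  refine ENNReal.ofReal_le_ofReal ?_
  linarith [le_negStieltjes_fun hb v, negStieltjes_fun_le hb (lt_add_one u)]

end Stieltjes

/-- As in the density case, the total is at most `(2B + η) b(x)`, now with `B = b(-∞)`. On `(-N, K]`
the measure has almost full mass `B` and the integrand is at least `b(x + N + 1)`; on `[x + N, ∞)`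
the integrand is almost `B` and the mass is at least `b(x + N + 1)`. Long-tailedness compares `b(x +
N + 1)` with `b(x)`. -/
theorem SubexpDistr.integral_middle_le {b : ℝ → ℝ} (hb : SubexpDistr b) (h0 : ∀ x, 0 ≤ b x)
    {δ : ℝ} (hδ : 0 < δ) :
    ∀ᶠ K in atTop, ∀ᶠ x in atTop,
      ∫ z in Ioc K (x - K), b (x - z) ∂(negStieltjes hb.antitone) ≤ δ * b x := by
  obtain ⟨M, hM⟩ := hb.bounded
  have hanti := hb.antitone
  set μ := negStieltjes hanti with hμ
  have hfin : IsFiniteMeasure μ := isFiniteMeasure_negStieltjes hanti hb.tendsto_zero hM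
  have hbdd : BddAbove (range b) := ⟨M, by rintro _ ⟨x, rfl⟩; exact hM x⟩
  set B := ⨆ y, b y with hB
  have hbB : ∀ x, b x ≤ B := fun x => le_ciSup hbdd x
  have hB0 : 0 < B := by
    obtain ⟨x, hx⟩ := hb.longTailed.eventually_pos.exists
    exact hx.trans_le (hbB x)
  -- The ends give at least `(2B - 3η)(1 - η) b(x)`, so the middle is at most `η(4 + 2B) b(x)`. The
  -- other two bounds on `η` keep both factors nonnegative.
  set η := min (δ / (6 + 2 * B)) (min (B / 2) (1 / 2)) with hη
  have hη0 : 0 < η := by positivity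
  have hη1 : η * (6 + 2 * B) ≤ δ := by
    rw [← le_div_iff₀ (by positivity)]; exact min_le_left _ _
  have hη2 : η ≤ B / 2 := (min_le_right _ _).trans (min_le_left _ _)
  have hη3 : η ≤ 1 / 2 := (min_le_right _ _).trans (min_le_right _ _)
  obtain ⟨N, hN1, hN2, hN0⟩ : ∃ N : ℝ, b N ≤ η ∧ B - η ≤ b (-N + 1) ∧ 0 ≤ N := by
    have h1 := hb.tendsto_zero.eventually_le_const hη0
    have h2 : ∀ᶠ N : ℝ in atTop, B - η ≤ b (-N + 1) :=
      (tendsto_atBot_add_const_right atTop 1 tendsto_neg_atTop_atBot).eventually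
        ((tendsto_atBot_ciSup hanti hbdd).eventually_const_le (by linarith))
    exact (h1.and (h2.and (eventually_ge_atTop 0))).exists
  have hconv := hb.conv_equiv.isLittleO.bound (show 0 < η / (2 * B) by positivity)
  have hint : ∀ x, Integrable (fun z => b (x - z)) μ := fun x =>
    Integrable.of_bound (hanti.measurable.comp (by fun_prop)).aestronglyMeasurable M
      (ae_of_all _ fun z => by rw [Real.norm_eq_abs, abs_of_nonneg (h0 _)]; exact hM _)
  filter_upwards [eventually_ge_atTop N, eventually_gt_atTop 0] with K hK hK0
  have hlt := hb.longTailed.eventually_le_mul_add (K := N + 1) (q := 1 + η) (by linarith)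
    (by linarith)
  filter_upwards [hconv, hlt, eventually_ge_atTop (2 * K)] with x hx hxN hxK
  have hup : ∫ z, b (x - z) ∂μ ≤ (2 * B + η) * b x := by
    simp only [Pi.sub_apply, Real.norm_eq_abs] at hx
    have h1 := (le_abs_self _).trans hx
    rw [abs_of_nonneg (mul_nonneg (by positivity) (h0 x))] at h1
    have h2 : η / (2 * B) * (2 * B * b x) = η * b x := by field_simp
    linarith
  have hS1 : (B - 2 * η) * b (x + N + 1) ≤ ∫ z in Ioc (-N) K, b (x - z) ∂μ := by
    have hm : B - 2 * η ≤ μ.real (Ioc (-N) K) := by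
      have h := le_negStieltjes_Ioc hanti (-N) K
      have h' := ENNReal.ofReal_le_iff_le_toReal (measure_ne_top μ _) |>.1 h
      have : b K ≤ η := (hanti hK).trans hN1
      exact le_trans (by linarith) h'
    calc (B - 2 * η) * b (x + N + 1) ≤ μ.real (Ioc (-N) K) * b (x + N + 1) :=
          mul_le_mul_of_nonneg_right hm (h0 _)
      _ = ∫ _ in Ioc (-N) K, b (x + N + 1) ∂μ := by simp
      _ ≤ _ := setIntegral_mono_on (integrable_const _).integrableOn (hint x).integrableOn
          measurableSet_Ioc fun z hz => hanti (by linarith [hz.1])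
  have hS3 : (B - η) * b (x + N + 1) ≤ ∫ z in Ici (x + N), b (x - z) ∂μ := by
    have hm : b (x + N + 1) ≤ μ.real (Ici (x + N)) := by
      have h := ofReal_le_negStieltjes_Ici hanti hb.tendsto_zero (x + N)
      have h' := ENNReal.ofReal_le_iff_le_toReal (measure_ne_top μ _) |>.1 h
      exact (hanti (by linarith)).trans h'
    calc (B - η) * b (x + N + 1) ≤ (B - η) * μ.real (Ici (x + N)) :=
          mul_le_mul_of_nonneg_left hm (by linarith)
      _ = ∫ _ in Ici (x + N), (B - η) ∂μ := by simp [mul_comm]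
      _ ≤ _ := setIntegral_mono_on (integrable_const _).integrableOn (hint x).integrableOn
          measurableSet_Ici fun z hz =>
            hN2.trans (hanti (by have : x + N ≤ z := hz; linarith))
  have hdis1 : Disjoint (Ioc (-N) K) (Ioc K (x - K)) :=
    Ioc_disjoint_Ioc_of_le le_rfl
  have hdis2 : Disjoint (Ioc (-N) K ∪ Ioc K (x - K)) (Ici (x + N)) := by
    rw [Set.disjoint_left]
    rintro z (hz | hz) (hz' : x + N ≤ z) <;> linarith [hz.2]
  have htot : (∫ z in Ioc (-N) K, b (x - z) ∂μ) + (∫ z in Ioc K (x - K), b (x - z) ∂μ) +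
      (∫ z in Ici (x + N), b (x - z) ∂μ) ≤ ∫ z, b (x - z) ∂μ := by
    rw [← setIntegral_union hdis1 measurableSet_Ioc (hint x).integrableOn (hint x).integrableOn,
      ← setIntegral_union hdis2 measurableSet_Ici (hint x).integrableOn (hint x).integrableOn]
    exact setIntegral_le_integral (hint x) (ae_of_all _ fun z => h0 _)
  have hbx : (1 - η) * b x ≤ b (x + N + 1) := by
    rw [← add_assoc] at hxN
    have : (1 - η) * b x ≤ (1 - η) * ((1 + η) * b (x + N + 1)) :=
      mul_le_mul_of_nonneg_left hxN (by linarith)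
    nlinarith [mul_nonneg (sq_nonneg η) (h0 (x + N + 1))]
  have hlow : (2 * B - 3 * η) * ((1 - η) * b x) ≤ (2 * B - 3 * η) * b (x + N + 1) :=
    mul_le_mul_of_nonneg_left hbx (by linarith)
  have hfinal : η * (6 + 2 * B) * b x ≤ δ * b x := mul_le_mul_of_nonneg_right hη1 (h0 x)
  nlinarith [mul_nonneg hη0.le (h0 x), mul_nonneg (sq_nonneg η) (h0 x)]

/-- Bounding `b(x - y)` by the `-db`-mass of `[x - y, ∞)` and exchanging integrals turns the
`ν`-integral into a `-db`-integral in `z`. For `K < z ≤ x - K` the inner integral is at most `2 b(x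
- z)`, which leaves the middle part already estimated; for `z > x - K` it is at most `2 b(K)`, small
for large `K`; for `z ≤ K` it vanishes. -/
theorem SubexpDistr.convMiddleSmall {b : ℝ → ℝ} (hb : SubexpDistr b) (h0 : ∀ x, 0 ≤ b x)
    {ν : Measure ℝ} [IsFiniteMeasure ν]
    (hν : ∀ᶠ z in atTop, ν (Ici z) ≤ ENNReal.ofReal (2 * b z)) :
    ConvMiddleSmall ν b := by
  intro δ hδ
  obtain ⟨M, hM⟩ := hb.bounded
  have hanti := hb.antitone
  set μ := negStieltjes hanti with hμ
  have hfin : IsFiniteMeasure μ := isFiniteMeasure_negStieltjes hanti hb.tendsto_zero hM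
  have hint : ∀ x, Integrable (fun z => b (x - z)) μ := fun x =>
    Integrable.of_bound (hanti.measurable.comp (by fun_prop)).aestronglyMeasurable M
      (ae_of_all _ fun z => by rw [Real.norm_eq_abs, abs_of_nonneg (h0 _)]; exact hM _)
  obtain ⟨Z, hZ⟩ := eventually_atTop.1 hν
  filter_upwards [hb.integral_middle_le h0 (show 0 < δ / 4 by positivity), eventually_ge_atTop Z,
    hb.tendsto_zero.eventually_le_const (show 0 < δ / 8 by positivity),
    eventually_ge_atTop 0] with K hK hKZ hbK hK0
  filter_upwards [hK, hb.longTailed.eventually_le_mul (K := K + 1) (q := 2) (by linarith)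
    (by norm_num)] with x hx hxK
  set F : ℝ → ℝ → ℝ≥0∞ := fun y z =>
    {p : ℝ × ℝ | x ≤ p.1 + p.2}.indicator (fun _ => 1) (y, z) with hF
  have hFm : Measurable (Function.uncurry F) :=
    measurable_const.indicator (measurableSet_le measurable_const (by fun_prop))
  have h1 : ∀ y, ENNReal.ofReal (b (x - y)) ≤ ∫⁻ z, F y z ∂μ := fun y => by
    refine (ofReal_le_negStieltjes_Ici hanti hb.tendsto_zero (x - y)).trans_eq ?_
    rw [← lintegral_indicator_one measurableSet_Ici]
    refine lintegral_congr fun z => ?_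
    simp only [hF, indicator_apply, mem_ofPred_eq, mem_Ici, sub_le_iff_le_add', Pi.one_apply]
  have h2 : ∀ z, ∫⁻ y in Ioo K (x - K), F y z ∂ν ≤
      (Ioc K (x - K)).indicator (fun z => ENNReal.ofReal (2 * b (x - z))) z +
        (Ici (x - K)).indicator (fun _ => ENNReal.ofReal (2 * b K)) z := fun z => by
    have hle : ∀ c, (∀ y, K < y → x ≤ y + z → c ≤ y) →
        ∫⁻ y in Ioo K (x - K), F y z ∂ν ≤ ν (Ici c) := fun c hc => by
      rw [← lintegral_indicator_one measurableSet_Ici, ← lintegral_indicator measurableSet_Ioo]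
      refine lintegral_mono fun y => ?_
      simp only [hF, indicator_apply, mem_ofPred_eq, mem_Ici, mem_Ioo, Pi.one_apply]
      split_ifs with h h' h'' <;> first | exact le_rfl | exact zero_le | exact absurd (hc y h.1 h') h''
    rcases le_or_gt z K with hz | hz
    · refine (le_of_eq ?_).trans zero_le
      refine setLIntegral_eq_zero measurableSet_Ioo fun y hy => ?_
      refine indicator_of_notMem (fun h => ?_) _
      have : x ≤ y + z := h
      linarith [hy.2]
    rcases le_or_gt z (x - K) with hz' | hz'
    · rw [indicator_of_mem (show z ∈ Ioc K (x - K) from ⟨hz, hz'⟩)]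
      refine le_trans ?_ le_self_add
      exact (hle (x - z) fun y _ h => by linarith).trans (hZ _ (by linarith))
    · rw [indicator_of_mem (show z ∈ Ici (x - K) from hz'.le)]
      refine le_trans ?_ le_add_self
      exact (hle K fun y h _ => h.le).trans (hZ _ hKZ)
  have h3 : ∫⁻ z in Ioc K (x - K), ENNReal.ofReal (2 * b (x - z)) ∂μ ≤
      ENNReal.ofReal (δ / 2 * b x) := by
    rw [← ofReal_integral_eq_lintegral_ofReal ((hint x).const_mul 2).integrableOn
      (ae_of_all _ fun z => mul_nonneg zero_le_two (h0 _)), integral_const_mul]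
    exact ENNReal.ofReal_le_ofReal (by linarith)
  have h4 : ENNReal.ofReal (2 * b K) * μ (Ici (x - K)) ≤ ENNReal.ofReal (δ / 2 * b x) := by
    refine (mul_le_mul_right (negStieltjes_Ici_le hanti hb.tendsto_zero (x - K)) _).trans ?_
    rw [← ENNReal.ofReal_mul (mul_nonneg zero_le_two (h0 _)), sub_sub]
    refine ENNReal.ofReal_le_ofReal ?_
    calc 2 * b K * b (x - (K + 1)) ≤ 2 * (δ / 8) * (2 * b x) :=
          mul_le_mul (by linarith) hxK (h0 _) (by positivity)
      _ = δ / 2 * b x := by ring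
  have hbm : Measurable fun z => ENNReal.ofReal (2 * b (x - z)) :=
    ((hanti.measurable.comp (by fun_prop)).const_mul 2).ennreal_ofReal
  calc ∫⁻ y in Ioo K (x - K), ENNReal.ofReal (b (x - y)) ∂ν
      ≤ ∫⁻ y in Ioo K (x - K), (∫⁻ z, F y z ∂μ) ∂ν := lintegral_mono h1
    _ = ∫⁻ z, (∫⁻ y in Ioo K (x - K), F y z ∂ν) ∂μ :=
        lintegral_lintegral_swap hFm.aemeasurable
    _ ≤ _ := lintegral_mono h2
    _ = (∫⁻ z in Ioc K (x - K), ENNReal.ofReal (2 * b (x - z)) ∂μ) +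
          ENNReal.ofReal (2 * b K) * μ (Ici (x - K)) := by
        rw [lintegral_add_left (hbm.indicator measurableSet_Ioc),
          lintegral_indicator measurableSet_Ioc, lintegral_indicator_const measurableSet_Ici]
    _ ≤ _ := add_le_add h3 h4
    _ = ENNReal.ofReal (δ * b x) := by
        rw [← ENNReal.ofReal_add (mul_nonneg (by positivity) (h0 x))
          (mul_nonneg (by positivity) (h0 x))]
        ring_nf

/-! ## Supersolutions -/

/-- The measure `a(x) dx`. -/
noncomputable def kernelMeasure (a : ℝ → ℝ) : Measure ℝ :=
  volume.withDensity fun y => ENNReal.ofReal (a y)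

theorem lintegral_kernelMeasure {a : ℝ → ℝ} (ha : AEMeasurable a) (g : ℝ → ℝ≥0∞) :
    ∫⁻ y, g y ∂(kernelMeasure a) = ∫⁻ y, ENNReal.ofReal (a y) * g y := by
  rw [kernelMeasure, ← setLIntegral_univ, setLIntegral_withDensity_ofReal ha g MeasurableSet.univ,
    setLIntegral_univ]

theorem IsKernel.kernelMeasure_apply {a : ℝ → ℝ} (ha : IsKernel a) {s : Set ℝ}
    (hs : MeasurableSet s) : kernelMeasure a s = ENNReal.ofReal (∫ y in s, a y) := by
  rw [kernelMeasure, withDensity_apply _ hs, ofReal_integral_eq_lintegral_ofReal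
    ha.integrable.integrableOn (ae_restrict_of_ae ha.nonneg)]

theorem IsKernel.isProbabilityMeasure {a : ℝ → ℝ} (ha : IsKernel a) :
    IsProbabilityMeasure (kernelMeasure a) :=
  ⟨by rw [ha.kernelMeasure_apply MeasurableSet.univ, setIntegral_univ, ha.integral_eq_one,
    ENNReal.ofReal_one]⟩

theorem IsKernel.integral_conv_le {a : ℝ → ℝ} (ha : IsKernel a) {φ : ℝ → ℝ}
    (hφm : AEStronglyMeasurable φ) (hφ0 : ∀ x, 0 ≤ φ x) {x r : ℝ} (hr : 0 ≤ r)
    (h : ∫⁻ y, ENNReal.ofReal (φ (x - y)) ∂(kernelMeasure a) ≤ ENNReal.ofReal r) :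
    ∫ y, a (x - y) * φ y ≤ r := by
  rw [← integral_sub_left_eq_self (fun y => a (x - y) * φ y) volume x]
  simp only [sub_sub_cancel]
  have hm : AEStronglyMeasurable (fun y => φ (x - y)) :=
    hφm.comp_quasiMeasurePreserving
      (Measure.measurePreserving_sub_left volume x).quasiMeasurePreserving
  rw [integral_eq_lintegral_of_nonneg_ae
    (ha.nonneg.mono fun y hy => mul_nonneg hy (hφ0 _)) (ha.integrable.1.mul hm)]
  refine ENNReal.toReal_le_of_le_ofReal hr (le_of_eq_of_le ?_ h)
  rw [lintegral_kernelMeasure ha.integrable.1.aemeasurable]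
  refine lintegral_congr_ae (ha.nonneg.mono fun y hy => ?_)
  exact ENNReal.ofReal_mul hy

/-- For `y ≤ K` one has `ψ(x - y) ≤ b(x - K) ≤ (1 + δ/2) b(x)`, and the rest is the negligible
middle. Neither `K` nor the threshold for `x` depends on `ψ`, so the cut-off level can be chosen
after them. -/
theorem ConvMiddleSmall.lintegral_Iio_le {b : ℝ → ℝ} {ν : Measure ℝ} [IsProbabilityMeasure ν]
    (hmid : ConvMiddleSmall ν b) (hlt : LongTailed b) (h0 : ∀ x, 0 ≤ b x) {ρ : ℝ}
    (hanti : AntitoneOn b (Ioi ρ)) {δ : ℝ} (hδ : 0 < δ) :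
    ∀ᶠ K in atTop, ∀ᶠ x in atTop, ∀ ψ : ℝ → ℝ≥0∞, (∀ z, ρ < z → ψ z ≤ ENNReal.ofReal (b z)) →
      ∫⁻ y in Iio (x - K), ψ (x - y) ∂ν ≤ ENNReal.ofReal ((1 + δ) * b x) := by
  filter_upwards [hmid (δ / 2) (half_pos hδ), eventually_gt_atTop ρ, eventually_ge_atTop 0]
    with K hK hKρ hK0
  filter_upwards [hK, hlt.eventually_le_mul hK0 (show 1 < 1 + δ / 2 by linarith),
    eventually_gt_atTop (K + ρ)] with x hx hxK hxρ ψ hψ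
  have hsub : Iio (x - K) ⊆ Iic K ∪ Ioo K (x - K) := fun y hy =>
    (le_or_gt y K).imp id fun h => ⟨h, hy⟩
  have h1 : ∫⁻ y in Iic K, ψ (x - y) ∂ν ≤ ENNReal.ofReal ((1 + δ / 2) * b x) := by
    calc ∫⁻ y in Iic K, ψ (x - y) ∂ν
        ≤ ∫⁻ _ in Iic K, ENNReal.ofReal ((1 + δ / 2) * b x) ∂ν := by
          refine setLIntegral_mono' measurableSet_Iic fun y hy => ?_
          have hy : y ≤ K := hy
          refine (hψ _ (by linarith)).trans (ENNReal.ofReal_le_ofReal (le_trans ?_ hxK))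
          exact hanti (show ρ < x - K by linarith) (show ρ < x - y by linarith) (by linarith)
      _ ≤ ENNReal.ofReal ((1 + δ / 2) * b x) := by
          rw [setLIntegral_const]
          exact mul_le_of_le_one_right' prob_le_one
  have h2 : ∫⁻ y in Ioo K (x - K), ψ (x - y) ∂ν ≤ ENNReal.ofReal (δ / 2 * b x) :=
    (setLIntegral_mono' measurableSet_Ioo fun y hy => hψ _ (by linarith [hy.2])).trans hx
  calc ∫⁻ y in Iio (x - K), ψ (x - y) ∂ν
      ≤ ∫⁻ y in Iic K ∪ Ioo K (x - K), ψ (x - y) ∂ν := lintegral_mono_set hsub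
    _ ≤ _ := lintegral_union_le _ _ _
    _ ≤ _ := add_le_add h1 h2
    _ = ENNReal.ofReal ((1 + δ) * b x) := by
        rw [← ENNReal.ofReal_add (mul_nonneg (by positivity) (h0 x))
          (mul_nonneg (by positivity) (h0 x))]
        ring_nf

/-- On `y ≥ x - K` the roles are exchanged: `a(y) ≤ b(x - K) ≤ 2 b(x)` comes out of the integral,
leaving at most `∫ ψ`. -/
theorem SubexpDensity.lintegral_conv_le {b : ℝ → ℝ} (hb : SubexpDensity b)
    (h0 : ∀ x, 0 ≤ b x) {M : ℝ} (hM : ∀ x, b x ≤ M) {ρ : ℝ} (hanti : AntitoneOn b (Ioi ρ))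
    {a : ℝ → ℝ} (ha : IsKernel a) (hab : ∀ᵐ x, ρ < x → a x ≤ b x) {δ : ℝ} (hδ : 0 < δ) :
    ∀ᶠ x in atTop, ∀ ψ : ℝ → ℝ≥0∞, (∀ z, ρ < z → ψ z ≤ ENNReal.ofReal (b z)) →
      ∫⁻ y, ψ (x - y) ∂(kernelMeasure a) ≤
        ENNReal.ofReal ((1 + δ) * b x) + ENNReal.ofReal (2 * b x) * ∫⁻ z, ψ z := by
  have := ha.isProbabilityMeasure
  have ham := ha.integrable.1.aemeasurable
  have hmid : ConvMiddleSmall (kernelMeasure a) b :=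
    hb.convMiddleSmall_of_le h0 hM hanti ham hab
  obtain ⟨K, hK, hK0⟩ :=
    ((hmid.lintegral_Iio_le hb.longTailed h0 hanti hδ).and (eventually_ge_atTop 0)).exists
  filter_upwards [hK, hb.longTailed.eventually_le_mul hK0 one_lt_two,
    eventually_gt_atTop (K + ρ)] with x hx hxK hxρ ψ hψ
  rw [← lintegral_add_compl _ (measurableSet_Iio (a := x - K)), compl_Iio]
  refine add_le_add (hx ψ hψ) ?_
  rw [kernelMeasure, setLIntegral_withDensity_ofReal ham _ measurableSet_Ici]
  calc ∫⁻ y in Ici (x - K), ENNReal.ofReal (a y) * ψ (x - y)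
      ≤ ∫⁻ y in Ici (x - K), ENNReal.ofReal (2 * b x) * ψ (x - y) := by
        refine lintegral_mono_ae ?_
        filter_upwards [ae_restrict_mem measurableSet_Ici, ae_restrict_of_ae hab] with y hy hay
        have hy : x - K ≤ y := hy
        refine mul_le_mul_left (ENNReal.ofReal_le_ofReal ?_) _
        exact (hay (by linarith)).trans ((hanti (show ρ < x - K by linarith)
          (show ρ < y by linarith) hy).trans hxK)
    _ ≤ ∫⁻ y, ENNReal.ofReal (2 * b x) * ψ (x - y) := setLIntegral_le_lintegral _ _
    _ = ENNReal.ofReal (2 * b x) * ∫⁻ z, ψ z := by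
        rw [lintegral_const_mul' _ _ ENNReal.ofReal_ne_top, lintegral_sub_left_eq_self]

/-- The function `b` cut off at the height `lam` on `s`, extended by `lam` outside `s`. -/
noncomputable def cutoff (s : Set ℝ) (lam : ℝ) (b : ℝ → ℝ) : ℝ → ℝ :=
  sᶜ.indicator (fun _ => lam) + s.indicator fun x => min lam (b x)

/-! ### Properties of the flattened function -/

section Cutoff

variable {s : Set ℝ} {lam : ℝ} {b : ℝ → ℝ}

theorem cutoff_of_mem {x : ℝ} (hx : x ∈ s) : cutoff s lam b x = min lam (b x) := by
  simp [cutoff, hx]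

theorem cutoff_of_notMem {x : ℝ} (hx : x ∉ s) : cutoff s lam b x = lam := by
  simp [cutoff, hx]

theorem cutoff_le (x : ℝ) : cutoff s lam b x ≤ lam := by
  by_cases hx : x ∈ s
  · rw [cutoff_of_mem hx]; exact min_le_left _ _
  · rw [cutoff_of_notMem hx]

theorem cutoff_nonneg (hl : 0 ≤ lam) (h0 : ∀ x, 0 ≤ b x) (x : ℝ) : 0 ≤ cutoff s lam b x := by
  by_cases hx : x ∈ s
  · rw [cutoff_of_mem hx]; exact le_min hl (h0 x)
  · rwa [cutoff_of_notMem hx]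

theorem cutoff_le_of_mem {x : ℝ} (hx : x ∈ s) : cutoff s lam b x ≤ b x := by
  rw [cutoff_of_mem hx]; exact min_le_right _ _

theorem aestronglyMeasurable_cutoff (hs : MeasurableSet s) (hb : AEStronglyMeasurable b) :
    AEStronglyMeasurable (cutoff s lam b) :=
  (aestronglyMeasurable_const.indicator hs.compl).add
    ((aestronglyMeasurable_const.inf hb).indicator hs)

theorem le_mul_cutoff {u U x : ℝ} (hl : 0 < lam) (h0 : ∀ x, 0 ≤ b x) (hU : 0 ≤ U) (hu : u ≤ U)
    (hub : x ∈ s → u ≤ b x) : u ≤ (1 + U / lam) * cutoff s lam b x := by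
  have hlam : U ≤ (1 + U / lam) * lam := by
    rw [add_mul, div_mul_cancel₀ _ hl.ne']; linarith
  by_cases hx : x ∈ s
  · rw [cutoff_of_mem hx]
    rcases min_choice lam (b x) with h | h <;> rw [h]
    · exact hu.trans hlam
    · refine (hub hx).trans (le_mul_of_one_le_left (h0 x) ?_)
      linarith [div_nonneg hU hl.le]
  · rw [cutoff_of_notMem hx]; exact hu.trans hlam

/-- Averaging against a probability density cannot exceed the maximal value `lam`, so only points
where the cut-off equals `b` and lies below `lam` need checking. -/
theorem IsKernel.integral_conv_cutoff_le {a : ℝ → ℝ} (ha : IsKernel a) (hs : MeasurableSet s)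
    (hb : AEStronglyMeasurable b) (h0 : ∀ x, 0 ≤ b x) (hl : 0 < lam) {δ : ℝ} (hδ : 0 < δ)
    (h : ∀ x ∈ s, b x < lam →
      ∫⁻ y, ENNReal.ofReal (cutoff s lam b (x - y)) ∂(kernelMeasure a) ≤
        ENNReal.ofReal ((1 + δ) * b x)) (x : ℝ) :
    ∫ y, a (x - y) * cutoff s lam b y ≤ (1 + δ) * cutoff s lam b x := by
  have := ha.isProbabilityMeasure
  refine ha.integral_conv_le (aestronglyMeasurable_cutoff hs hb) (cutoff_nonneg hl.le h0)
    (mul_nonneg (by linarith) (cutoff_nonneg hl.le h0 x)) ?_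
  by_cases hx : x ∈ s ∧ b x < lam
  · rw [cutoff_of_mem hx.1, min_eq_right hx.2.le]
    exact h x hx.1 hx.2
  · have hcx : cutoff s lam b x = lam := by
      by_cases hxs : x ∈ s
      · rw [cutoff_of_mem hxs, min_eq_left (not_lt.1 fun h => hx ⟨hxs, h⟩)]
      · exact cutoff_of_notMem hxs
    rw [hcx]
    calc ∫⁻ y, ENNReal.ofReal (cutoff s lam b (x - y)) ∂(kernelMeasure a)
        ≤ ∫⁻ _, ENNReal.ofReal lam ∂(kernelMeasure a) :=
          lintegral_mono fun y => ENNReal.ofReal_le_ofReal (cutoff_le _)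
      _ = ENNReal.ofReal lam := by simp
      _ ≤ _ := ENNReal.ofReal_le_ofReal (le_mul_of_one_le_left hl.le (by linarith))

end Cutoff

/-! ### Reflection, and supersolutions for `S(ℝ)` and `MS(ℝ)` -/

theorem IsKernel.comp_neg {a : ℝ → ℝ} (ha : IsKernel a) : IsKernel fun x => a (-x) where
  nonneg := (Measure.measurePreserving_neg volume).quasiMeasurePreserving.ae ha.nonneg
  integrable := ha.integrable.comp_neg
  essBounded := ha.essBounded.comp_measurePreserving (Measure.measurePreserving_neg volume)
  integral_eq_one := by rw [integral_neg_eq_self a volume]; exact ha.integral_eq_one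

theorem lintegral_kernelMeasure_neg {a : ℝ → ℝ} (ha : IsKernel a) (ψ : ℝ → ℝ≥0∞) (x : ℝ) :
    ∫⁻ y, ψ (-(-x - y)) ∂(kernelMeasure fun y => a (-y)) = ∫⁻ y, ψ (x - y) ∂(kernelMeasure a) := by
  rw [lintegral_kernelMeasure ha.integrable.1.aemeasurable,
    lintegral_kernelMeasure ha.comp_neg.integrable.1.aemeasurable,
    ← lintegral_neg_eq_self (fun y => ENNReal.ofReal (a y) * ψ (x - y))]
  refine lintegral_congr fun y => ?_
  ring_nf

theorem ClassS.integrable {b : ℝ → ℝ} (hb : ClassS b) : Integrable b := by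
  have h1 := hb.1.subexp.integrableOn
  have h2 : IntegrableOn b (Iio 0) := by
    have h := (Measure.measurePreserving_neg (volume : Measure ℝ)).integrableOn_comp_preimage
      (MeasurableEquiv.neg ℝ).measurableEmbedding (f := b) (s := Iio 0)
    rw [← h]
    simpa using! hb.2.subexp.integrableOn
  rw [← integrableOn_univ, ← Iio_union_Ici (a := (0 : ℝ)), integrableOn_union]
  exact ⟨h2, (integrableOn_Ici_iff_integrableOn_Ioi).2 h1⟩

/-- The right tail and, by reflection, the left tail both satisfy `SubexpDensity.lintegral_conv_le`.
Its extra term `2 b(x) ∫ φ` is at most `(δ/2) b(x)` once `lam` is small. -/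
theorem ClassS.exists_supersolution {b : ℝ → ℝ} (hb : ClassS b) {a : ℝ → ℝ} (ha : IsKernel a)
    {ρ₀ : ℝ} (hab : ∀ᵐ x, ρ₀ < |x| → a x ≤ b x) {δ : ℝ} (hδ : 0 < δ) :
    ∃ ρ, ρ₀ ≤ ρ ∧ ∃ lam, 0 < lam ∧ ∀ x,
      ∫ y, a (x - y) * cutoff {x | ρ < |x|} lam b y ≤
        (1 + δ) * cutoff {x | ρ < |x|} lam b x := by
  obtain ⟨ρ₁, hρ₁, -, hd₁, -⟩ := hb.1.tailDecreasing
  obtain ⟨ρ₂, hρ₂, -, hd₂, -⟩ := hb.2.tailDecreasing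
  have h0 := hb.1.nonneg
  obtain ⟨M, hM⟩ := hb.1.bounded
  set ρ := max ρ₀ (max ρ₁ ρ₂) with hρ
  have hρ1 : ρ₁ ≤ ρ := (le_max_left _ _).trans (le_max_right _ _)
  have hρ2 : ρ₂ ≤ ρ := (le_max_right _ _).trans (le_max_right _ _)
  have hρ0 : 0 ≤ ρ := hρ₁.trans hρ1
  have ha1 : AntitoneOn b (Ioi ρ) := hd₁.antitoneOn.mono (Ioi_subset_Ioi hρ1)
  have ha2 : AntitoneOn (fun x => b (-x)) (Ioi ρ) := hd₂.antitoneOn.mono (Ioi_subset_Ioi hρ2)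
  have hab' : ∀ᵐ x, ρ < |x| → a x ≤ b x := hab.mono fun x hx h => hx ((le_max_left _ _).trans_lt h)
  have hR := hb.1.subexp.lintegral_conv_le h0 hM ha1 ha
    (hab'.mono fun x hx h => hx (h.trans_le (le_abs_self x))) (half_pos hδ)
  have hL := hb.2.subexp.lintegral_conv_le (fun x => h0 (-x)) (fun x => hM (-x)) ha2 ha.comp_neg
    (((Measure.measurePreserving_neg volume).quasiMeasurePreserving.ae hab').mono
      fun x hx h => hx (by rw [abs_neg]; exact h.trans_le (le_abs_self x))) (half_pos hδ)
  obtain ⟨X₀, hX₀⟩ := eventually_atTop.1 (hR.and (hL.and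
    (hb.1.subexp.longTailed.eventually_pos.and hb.2.subexp.longTailed.eventually_pos)))
  set X := max X₀ (ρ + 1) with hX
  have hXρ : ρ < X := (lt_add_one ρ).trans_le (le_max_right _ _)
  have hXpos := (hX₀ X (le_max_left _ _)).2.2
  set s : Set ℝ := {x | ρ < |x|} with hs
  have hsm : MeasurableSet s := measurableSet_lt measurable_const (by fun_prop)
  have hbm := hb.integrable.aestronglyMeasurable
  -- Dominated convergence: for `lam ≤ 1` the cut-off is bounded by the indicator of `[-ρ, ρ]` plus
  -- `b`.
  have hlim : Tendsto (fun lam => ∫ z, cutoff s lam b z) (𝓝[>] 0) (𝓝 (∫ _ : ℝ, (0 : ℝ))) := by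
    refine tendsto_integral_filter_of_dominated_convergence
      (fun z => (Icc (-ρ) ρ).indicator (fun _ => 1) z + b z)
      (Eventually.of_forall fun lam => aestronglyMeasurable_cutoff hsm hbm) ?_
      (((integrableOn_const (by simp)).integrable_indicator measurableSet_Icc).add hb.integrable) ?_
    · filter_upwards [Ioc_mem_nhdsGT zero_lt_one] with lam hlam
      refine ae_of_all _ fun z => ?_
      rw [Real.norm_eq_abs, abs_of_nonneg (cutoff_nonneg hlam.1.le h0 z)]
      by_cases hz : z ∈ s
      · refine (cutoff_le_of_mem hz).trans (le_add_of_nonneg_left ?_)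
        exact indicator_nonneg (fun _ _ => zero_le_one) z
      · rw [indicator_of_mem (show z ∈ Icc (-ρ) ρ from abs_le.1 (not_lt.1 fun h => hz h))]
        linarith [cutoff_le (s := s) (lam := lam) (b := b) z, hlam.2, h0 z]
    · refine ae_of_all _ fun z => ?_
      refine tendsto_of_tendsto_of_tendsto_of_le_of_le' tendsto_const_nhds
        (tendsto_id.mono_left nhdsWithin_le_nhds) ?_ (Eventually.of_forall fun lam => cutoff_le z)
      filter_upwards [self_mem_nhdsWithin] with lam hlam
      exact cutoff_nonneg (le_of_lt hlam) h0 z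
  rw [integral_zero] at hlim
  -- With `lam ≤ b(±X)`, monotonicity of the tails forces `|x| ≥ X` wherever `|x| > ρ` and `b(x) <
  -- lam`.
  have hlam1 : ∀ᶠ lam in 𝓝[>] 0, lam ∈ Ioc 0 (b X) := Ioc_mem_nhdsGT hXpos.1
  have hlam2 : ∀ᶠ lam in 𝓝[>] 0, lam ∈ Ioc 0 (b (-X)) := Ioc_mem_nhdsGT hXpos.2
  obtain ⟨lam, hlamδ, hl1, hl2⟩ := ((hlim.eventually_le_const
    (show 0 < δ / 4 by positivity)).and (hlam1.and hlam2)).exists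
  have hl : 0 < lam := hl1.1
  have hcint : Integrable (cutoff s lam b) := by
    refine Integrable.add ?_ ?_
    · refine IntegrableOn.integrable_indicator (integrableOn_const ?_) hsm.compl
      have : sᶜ = Icc (-ρ) ρ := by
        ext z; simp only [hs, mem_compl_iff, mem_ofPred_eq, not_lt, abs_le, mem_Icc]
      rw [this]
      simp
    · refine (hb.integrable.mono' (aestronglyMeasurable_const.inf hbm)
        (ae_of_all _ fun z => ?_)).indicator hsm
      change |min lam (b z)| ≤ b z
      rw [abs_of_nonneg (le_min hl.le (h0 z))]
      exact min_le_right _ _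
  have hψ : ∫⁻ z, ENNReal.ofReal (cutoff s lam b z) ≤ ENNReal.ofReal (δ / 4) := by
    rw [← ofReal_integral_eq_lintegral_ofReal hcint (ae_of_all _ (cutoff_nonneg hl.le h0))]
    exact ENNReal.ofReal_le_ofReal hlamδ
  have hfin : ∀ x, ENNReal.ofReal ((1 + δ / 2) * b x) + ENNReal.ofReal (2 * b x) *
      ∫⁻ z, ENNReal.ofReal (cutoff s lam b z) ≤ ENNReal.ofReal ((1 + δ) * b x) := fun x => by
    refine (add_le_add_right (mul_le_mul_right hψ _) _).trans_eq ?_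
    rw [← ENNReal.ofReal_mul (mul_nonneg zero_le_two (h0 x)),
      ← ENNReal.ofReal_add (mul_nonneg (by positivity) (h0 x))
        (mul_nonneg (mul_nonneg zero_le_two (h0 x)) (by positivity))]
    ring_nf
  refine ⟨ρ, le_max_left _ _, lam, hl, ha.integral_conv_cutoff_le hsm hbm h0 hl hδ
    fun x hxs hx => ?_⟩
  rcases le_total 0 x with hx0 | hx0
  · have hxρ : ρ < x := by simpa [hs, abs_of_nonneg hx0] using hxs
    have hXx : X ≤ x := by
      by_contra hlt
      exact absurd (ha1 hxρ hXρ (not_le.1 hlt).le) (not_le.2 (hx.trans_le hl1.2))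
    refine ((hX₀ x ((le_max_left _ _).trans hXx)).1
      (fun z => ENNReal.ofReal (cutoff s lam b z)) fun z hz => ?_).trans (hfin x)
    exact ENNReal.ofReal_le_ofReal (cutoff_le_of_mem (hz.trans_le (le_abs_self z)))
  · have hxρ : ρ < -x := by simpa [hs, abs_of_nonpos hx0] using hxs
    have hXx : X ≤ -x := by
      by_contra hlt
      have := ha2 hxρ hXρ (not_le.1 hlt).le
      simp only [neg_neg] at this
      exact absurd this (not_le.2 (hx.trans_le hl2.2))
    have h := (hX₀ (-x) ((le_max_left _ _).trans hXx)).2.1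
      (fun z => ENNReal.ofReal (cutoff s lam b (-z))) fun z hz =>
        ENNReal.ofReal_le_ofReal (cutoff_le_of_mem
          (show ρ < |-z| by rw [abs_neg]; exact hz.trans_le (le_abs_self z)))
    rw [lintegral_kernelMeasure_neg ha (fun z => ENNReal.ofReal (cutoff s lam b z)),
      lintegral_neg_eq_self (fun z => ENNReal.ofReal (cutoff s lam b z)), neg_neg] at h
    exact h.trans (hfin x)

/-- Here `b` need not be integrable. For `y ≥ x - K` the cut-off is bounded by `lam`, and the kernel
mass there is at most `2 b(x - K) ≤ 4 b(x)`; hence `lam ≤ δ/8`. -/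
theorem exists_supersolution_of_antitone {b : ℝ → ℝ} (h0 : ∀ x, 0 ≤ b x) (hanti : Antitone b)
    (hlt : LongTailed b) {a : ℝ → ℝ} (ha : IsKernel a)
    (hmid : ConvMiddleSmall (kernelMeasure a) b)
    (hν : ∀ᶠ z in atTop, kernelMeasure a (Ici z) ≤ ENNReal.ofReal (2 * b z)) (ρ : ℝ)
    {δ : ℝ} (hδ : 0 < δ) :
    ∃ lam, 0 < lam ∧ ∀ x,
      ∫ y, a (x - y) * cutoff (Ioi ρ) lam b y ≤ (1 + δ) * cutoff (Ioi ρ) lam b x := by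
  have := ha.isProbabilityMeasure
  obtain ⟨K, hK, hK0⟩ := ((hmid.lintegral_Iio_le hlt h0 (hanti.antitoneOn (Ioi ρ))
    (half_pos hδ)).and (eventually_ge_atTop 0)).exists
  obtain ⟨X, hX⟩ := eventually_atTop.1 (hK.and ((hlt.eventually_le_mul hK0 one_lt_two).and
    (((tendsto_atTop_add_const_right atTop (-K) tendsto_id).eventually hν).and
      hlt.eventually_pos)))
  have hXpos := (hX X le_rfl).2.2.2
  set lam := min (δ / 8) (b X) with hlam
  have hl : 0 < lam := by positivity
  refine ⟨lam, hl, ha.integral_conv_cutoff_le measurableSet_Ioi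
    hanti.measurable.aestronglyMeasurable h0 hl hδ fun x hxs hx => ?_⟩
  have hXx : X ≤ x := by
    by_contra hlt
    exact absurd (hanti (not_le.1 hlt).le) (not_le.2 (hx.trans_le (min_le_right _ _)))
  obtain ⟨h1, h2, h3, -⟩ := hX x hXx
  rw [← lintegral_add_compl _ (measurableSet_Iio (a := x - K)), compl_Iio]
  have h4 : ∫⁻ y in Ici (x - K), ENNReal.ofReal (cutoff (Ioi ρ) lam b (x - y)) ∂(kernelMeasure a) ≤
      ENNReal.ofReal (δ / 2 * b x) := by
    calc _ ≤ ∫⁻ _ in Ici (x - K), ENNReal.ofReal (δ / 8) ∂(kernelMeasure a) :=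
          lintegral_mono fun y => ENNReal.ofReal_le_ofReal ((cutoff_le _).trans (min_le_left _ _))
      _ = ENNReal.ofReal (δ / 8) * kernelMeasure a (Ici (x - K)) := setLIntegral_const _ _
      _ ≤ ENNReal.ofReal (δ / 8) * ENNReal.ofReal (2 * b (x - K)) := by
          refine mul_le_mul_right ?_ _
          simpa [sub_eq_add_neg] using h3
      _ ≤ ENNReal.ofReal (δ / 2 * b x) := by
          rw [← ENNReal.ofReal_mul (by positivity)]
          refine ENNReal.ofReal_le_ofReal ?_
          have := mul_le_mul_of_nonneg_left h2 hδ.le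
          linarith
  refine (add_le_add (h1 _ fun z hz => ENNReal.ofReal_le_ofReal (cutoff_le_of_mem hz)) h4).trans_eq ?_
  rw [← ENNReal.ofReal_add (mul_nonneg (by positivity) (h0 x))
    (mul_nonneg (by positivity) (h0 x))]
  ring_nf

theorem IsKernel.eventually_kernelMeasure_Ici_le {b : ℝ → ℝ} (hanti : Antitone b)
    (hlt : LongTailed b) {a : ℝ → ℝ} (ha : IsKernel a) {ρ : ℝ}
    (hab : ∀ᵐ x, ρ < x → ∫ y in Ioi x, a y ≤ b x) :
    ∀ᶠ z in atTop, kernelMeasure a (Ici z) ≤ ENNReal.ofReal (2 * b z) := by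
  filter_upwards [eventually_gt_atTop (ρ + 1), hlt.eventually_le_mul zero_le_one one_lt_two]
    with z hz hz2
  -- The tail bound is only almost everywhere, so a good point is picked just left of `z`;
  -- long-tailedness pays for the shift with the factor `2`.
  have hex : ∃ x ∈ Ioo (z - 1) z, ρ < x → ∫ y in Ioi x, a y ≤ b x := by
    have h := (ae_restrict_mem (μ := volume) (measurableSet_Ioo (a := z - 1) (b := z))).and
      (ae_restrict_of_ae hab)
    have hne : (ae (volume.restrict (Ioo (z - 1) z))).NeBot := by
      rw [ae_neBot, Ne, Measure.restrict_eq_zero]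
      simp
    exact h.exists
  obtain ⟨x, hx, hxa⟩ := hex
  calc kernelMeasure a (Ici z) ≤ kernelMeasure a (Ioi x) :=
        measure_mono fun y hy => hx.2.trans_le hy
    _ = ENNReal.ofReal (∫ y in Ioi x, a y) := ha.kernelMeasure_apply measurableSet_Ioi
    _ ≤ ENNReal.ofReal (2 * b z) :=
        ENNReal.ofReal_le_ofReal ((hxa (by linarith [hx.1])).trans ((hanti hx.1.le).trans hz2))

theorem ClassMS.exists_supersolution {b : ℝ → ℝ} (hb : ClassMS b) {a : ℝ → ℝ} (ha : IsKernel a)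
    {ρ : ℝ} (hab : ∀ᵐ x, ρ < x → ∫ y in Ioi x, a y ≤ b x) {δ : ℝ} (hδ : 0 < δ) :
    ∃ lam, 0 < lam ∧ ∀ x,
      ∫ y, a (x - y) * cutoff (Ioi ρ) lam b y ≤ (1 + δ) * cutoff (Ioi ρ) lam b x := by
  obtain ⟨hM, hS⟩ := hb
  have := ha.isProbabilityMeasure
  have hlt : LongTailed b := hS.elim (fun h => h.subexp.longTailed) fun h => h.subexp.longTailed
  -- A non-decreasing function tending to `0` is nowhere positive, against long-tailedness.
  have hanti : Antitone b := by
    refine hM.monotone.resolve_left fun hmono => ?_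
    obtain ⟨x, hx⟩ := hlt.eventually_pos.exists
    exact absurd (hmono.ge_of_tendsto hM.tendsto_zero x) (not_le.2 hx)
  have hν := ha.eventually_kernelMeasure_Ici_le hanti hlt hab
  refine exists_supersolution_of_antitone hM.nonneg hanti hlt ha ?_ hν ρ hδ
  obtain ⟨M, hMb⟩ := hM.bounded
  rcases hS with h | h
  · exact h.subexp.convMiddleSmall_of_tail_le hM.nonneg hMb hanti hν
  · exact h.subexp.convMiddleSmall hM.nonneg hν

/-! ## Decay outside the fronts -/

theorem eventually_le_exp_of_rightFront_lt {β : ℝ} (hβ : 0 < β) {b : ℝ → ℝ}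
    (hd : TailDecreasing b) (hc : TailContinuous b) :
    ∀ᶠ t in atTop, ∀ x, rightFront β b t < x → b x ≤ Real.exp (-(β * t)) := by
  obtain ⟨hlim, ρ, hρ⟩ := rightFront_spec hβ hd hc
  obtain ⟨ρ', -, -, hanti, -⟩ := hd
  filter_upwards [hρ, hlim.eventually_gt_atTop ρ, hlim.eventually_gt_atTop ρ'] with t h1 h2 h3 x hx
  rw [← (h1 _ h2).2 rfl]
  exact (hanti h3 (h3.trans hx) hx).le

/-- A real-valued essential supremum obeys the expected bounds only for a nonzero measure and a
function essentially bounded on both sides. -/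
theorem tendsto_essSup_zero {α : Type*} [MeasurableSpace α] {f : ℝ → α → ℝ} {μ : ℝ → Measure α}
    {c : ℝ → ℝ} (hμ : ∀ t, μ t ≠ 0) (hc : Tendsto c atTop (𝓝 0))
    (h0 : ∀ᶠ t in atTop, ∀ᵐ x ∂(μ t), 0 ≤ f t x)
    (h1 : ∀ᶠ t in atTop, ∀ᵐ x ∂(μ t), f t x ≤ c t) :
    Tendsto (fun t => essSup (f t) (μ t)) atTop (𝓝 0) := by
  refine tendsto_of_tendsto_of_tendsto_of_le_of_le' tendsto_const_nhds hc ?_ ?_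
  · filter_upwards [h0, h1] with t ht0 ht1
    have : (ae (μ t)).NeBot := ae_neBot.2 (hμ t)
    refine le_limsup_of_le ⟨c t, ht1⟩ fun d hd => ?_
    obtain ⟨x, hx, hxd⟩ := (ht0.and hd).exists
    exact hx.trans hxd
  · filter_upwards [h0, h1] with t ht0 ht1
    have : (ae (μ t)).NeBot := ae_neBot.2 (hμ t)
    have hb : IsBoundedUnder (· ≥ ·) (ae (μ t)) (f t) := ⟨0, ht0⟩
    exact essSup_le_of_ae_le (c t) ht1 hb.isCoboundedUnder_le

/-- If `b` is at most `e^{-β(1+ε)t}` outside `L t` and a flattening of `b` at a low level is a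
supersolution with a factor close to `1`, then the solution vanishes uniformly outside `L t`. -/
theorem IsLinearSolution.tendsto_essSup_compl {ϰ m : ℝ} (hm : 0 < m) (hβ : 0 < ϰ - m)
    {a : ℝ → ℝ} (ha : IsKernel a) {u₀ : Lp ℝ ∞ (volume : Measure ℝ)} (hu₀ : ∀ᵐ x : ℝ, 0 ≤ u₀ x)
    {w : ℝ → Lp ℝ ∞ (volume : Measure ℝ)} (hw : IsLinearSolution ϰ m a u₀ w) {b : ℝ → ℝ}
    (h0 : ∀ x, 0 ≤ b x) (hbm : AEStronglyMeasurable b) {ε : ℝ} (hε : 0 < ε) {Λ : ℝ → Set ℝ}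
    (hΛm : ∀ t, MeasurableSet (Λ t)) (hΛ : ∀ t, volume (Λ t)ᶜ ≠ 0)
    (hsup : ∀ δ > 0, ∃ s, MeasurableSet s ∧ (∀ᵐ x, x ∈ s → u₀ x ≤ b x) ∧
      (∀ᶠ t in atTop, ∀ x ∈ (Λ t)ᶜ, x ∈ s ∧ b x ≤ Real.exp (-((ϰ - m) * (t + ε * t)))) ∧
      ∃ lam, 0 < lam ∧ ∀ x, ∫ y, a (x - y) * cutoff s lam b y ≤ (1 + δ) * cutoff s lam b x) :
    Tendsto (fun t : ℝ => essSup (w t) (volume.restrict (Λ t)ᶜ)) atTop (𝓝 0) := by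
  have hϰ : 0 < ϰ := by linarith
  -- This `δ` makes the growth rate `β + βε/2`, half of `βε` short of the decay rate `β(1 + ε)` of
  -- `b` outside `Λ t`.
  obtain ⟨s, hsm, hus, hsΛ, lam, hl, hφ⟩ := hsup ((ϰ - m) * ε / (2 * ϰ)) (by positivity)
  set δ := (ϰ - m) * ε / (2 * ϰ) with hδ
  have hδ' : ϰ * δ = (ϰ - m) * ε / 2 := by rw [hδ]; field_simp
  set C := 1 + ‖u₀‖ / lam with hC
  have hC0 : 0 ≤ C := by positivity
  have hup : ∀ᵐ x, u₀ x ≤ C * cutoff s lam b x := by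
    filter_upwards [hus, Lp.ae_abs_le_norm u₀] with x h1 h2
    exact le_mul_cutoff hl h0 (norm_nonneg _) ((le_abs_self _).trans h2) h1
  have hδ0 : 0 < δ := by positivity
  have hq : 0 ≤ 1 + δ := by linarith
  refine tendsto_essSup_zero (c := fun t => C * Real.exp (-((ϰ - m) * ε / 2 * t)))
    (fun t => by rw [Ne, Measure.restrict_eq_zero]; exact hΛ t) ?_ ?_ ?_
  · have h : Tendsto (fun t : ℝ => Real.exp (-((ϰ - m) * ε / 2 * t))) atTop (𝓝 0) :=
      Real.tendsto_exp_neg_atTop_nhds_zero.comp (tendsto_id.const_mul_atTop (by positivity))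
    simpa using h.const_mul C
  · filter_upwards [eventually_ge_atTop 0] with t ht
    exact ae_restrict_of_ae (hw.ae_nonneg hϰ.le ha hu₀ ht)
  · filter_upwards [eventually_ge_atTop 0, hsΛ] with t ht hst
    have hle := hw.ae_le hϰ.le ha (aestronglyMeasurable_cutoff hsm hbm) (B := lam)
      (fun x => by rw [abs_of_nonneg (cutoff_nonneg hl.le h0 x)]; exact cutoff_le x)
      hC0 hq (ae_of_all _ hφ) hup ht
    filter_upwards [ae_restrict_of_ae hle, ae_restrict_mem (hΛm t).compl] with x hx hxΛ
    obtain ⟨hxs, hbx⟩ := hst x hxΛ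
    refine hx.trans ?_
    rw [mul_assoc]
    refine mul_le_mul_of_nonneg_left ?_ hC0
    calc Real.exp ((ϰ * (1 + δ) - m) * t) * cutoff s lam b x
        ≤ Real.exp ((ϰ * (1 + δ) - m) * t) * Real.exp (-((ϰ - m) * (t + ε * t))) :=
          mul_le_mul_of_nonneg_left ((cutoff_le_of_mem hxs).trans hbx) (Real.exp_pos _).le
      _ = Real.exp (-((ϰ - m) * ε / 2 * t)) := by
          rw [← Real.exp_add]
          congr 1
          linear_combination t * hδ'

theorem tendsto_add_mul_atTop {ε : ℝ} (hε : 0 < ε) :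
    Tendsto (fun t : ℝ => t + ε * t) atTop atTop :=
  tendsto_id.atTop_add_atTop (tendsto_id.const_mul_atTop hε)

theorem proposition5p3 (ϰ m : ℝ) (hm : 0 < m) (hβ : 0 < ϰ - m)
    (a : ℝ → ℝ) (ha : IsKernel a)
    (u₀ : Lp ℝ ∞ (volume : Measure ℝ)) (hu₀ : ∀ᵐ x : ℝ, 0 ≤ u₀ x) (hne : NontrivialInit u₀)
    (w : ℝ → Lp ℝ ∞ (volume : Measure ℝ)) (hw : IsLinearSolution ϰ m a u₀ w)
    (b : ℝ → ℝ) :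
    (CondC1 u₀ → ClassS b →
      (∃ ρ : ℝ, 0 < ρ ∧ ∀ᵐ x : ℝ, ρ < |x| → max (a x) (u₀ x) ≤ b x) →
      ∀ ε ∈ Ioo (0 : ℝ) 1,
        Tendsto (fun t : ℝ => essSup (w t) (volume.restrict (LambdaS (ϰ - m) ε b t)ᶜ))
          atTop (𝓝 0)) ∧
    (CondC2 u₀ → ClassMS b →
      (∃ ρ : ℝ, 0 < ρ ∧ ∀ᵐ x : ℝ, ρ < x → max (∫ y in Ioi x, a y) (u₀ x) ≤ b x) →
      ∀ ε ∈ Ioo (0 : ℝ) 1,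
        Tendsto (fun t : ℝ => essSup (w t) (volume.restrict (LambdaMS (ϰ - m) ε b t)ᶜ))
          atTop (𝓝 0)) := by
  -- The complement of each `Λ_ε⁺` contains a right half-line, so the essential supremum is over a
  -- non-null set.
  have hpos : ∀ r : ℝ, ∀ s : Set ℝ, Ioi r ⊆ s → volume s ≠ 0 := fun r s hs h => by
    have := measure_mono_null hs h
    simp at this
  constructor
  · rintro - hb ⟨ρ₀, -, hab⟩ ε ⟨hε, -⟩
    refine hw.tendsto_essSup_compl hm hβ ha hu₀ hb.1.nonneg hb.integrable.aestronglyMeasurable hε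
      (fun t => measurableSet_Icc)
      (fun t => hpos (rightFront (ϰ - m) b (t + ε * t)) _ fun x hx h => not_le.2 hx h.2)
      fun δ hδ => ?_
    obtain ⟨ρ, hρ, lam, hl, hφ⟩ := hb.exists_supersolution ha
      (hab.mono fun x hx h => (le_max_left _ _).trans (hx h)) hδ
    have hT := tendsto_add_mul_atTop hε
    refine ⟨{x | ρ < |x|}, measurableSet_lt measurable_const (by fun_prop),
      hab.mono fun x hx h => (le_max_right _ _).trans (hx (hρ.trans_lt h)), ?_, lam, hl, hφ⟩
    filter_upwards [hT.eventually (eventually_le_exp_of_rightFront_lt hβ hb.1.tailDecreasing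
        hb.1.tailContinuous),
      hT.eventually (eventually_le_exp_of_rightFront_lt hβ hb.2.tailDecreasing
        hb.2.tailContinuous),
      ((rightFront_spec hβ hb.1.tailDecreasing hb.1.tailContinuous).1.comp
        hT).eventually_ge_atTop ρ,
      ((rightFront_spec hβ hb.2.tailDecreasing hb.2.tailContinuous).1.comp
        hT).eventually_ge_atTop ρ] with t h1 h2 h3 h4 x hx
    rw [LambdaS, mem_compl_iff, mem_Icc, not_and_or, not_le, not_le, lt_neg] at hx
    rcases hx with hx | hx
    · refine ⟨(h4.trans_lt hx).trans_le (neg_le_abs x), ?_⟩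
      simpa using h2 (-x) hx
    · exact ⟨(h3.trans_lt hx).trans_le (le_abs_self x), h1 x hx⟩
  · rintro - hb ⟨ρ, -, hab⟩ ε ⟨hε, -⟩
    have hd : TailDecreasing b := hb.2.elim (fun h => h.tailDecreasing) fun h => h.tailDecreasing
    have hc : TailContinuous b := hb.2.elim (fun h => h.tailContinuous) fun h => h.tailContinuous
    have hbm : Measurable b := hb.1.monotone.elim Monotone.measurable Antitone.measurable
    refine hw.tendsto_essSup_compl hm hβ ha hu₀ hb.1.nonneg hbm.aestronglyMeasurable hε
      (fun t => measurableSet_Iic)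
      (fun t => hpos (rightFront (ϰ - m) b (t + ε * t)) _ fun x hx h => not_le.2 hx (mem_Iic.1 h))
      fun δ hδ => ?_
    obtain ⟨lam, hl, hφ⟩ := hb.exists_supersolution ha
      (hab.mono fun x hx h => (le_max_left _ _).trans (hx h)) hδ
    have hT := tendsto_add_mul_atTop hε
    refine ⟨Ioi ρ, measurableSet_Ioi,
      hab.mono fun x hx h => (le_max_right _ _).trans (hx h), ?_, lam, hl, hφ⟩
    filter_upwards [hT.eventually (eventually_le_exp_of_rightFront_lt hβ hd hc),
      ((rightFront_spec hβ hd hc).1.comp hT).eventually_ge_atTop ρ] with t h1 h2 x hx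
    have hx : rightFront (ϰ - m) b (t + ε * t) < x := not_le.1 hx
    exact ⟨h2.trans_lt hx, h1 x hx⟩
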